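/- Let $n\ge 1$ be an integer, $Q=2n+2$, $\alpha>Q$ real, and $p_\alpha=\frac{2Q}{Q+\alpha}\in(0,1)$. Let $\mathbb S^{2n+1}$ be the unit sphere of $\mathbb C^{n+1}$ with its Euclidean surface measure $d\xi$ and total measure $|\mathbb S^{2n+1}|$, write $\xi\cdot\bar\eta=\sum_{j=1}^{n+1}\xi_j\bar\eta_j$, and $\|f\|_{p}=\left(\int_{\mathbb S^{2n+1}}|f|^{p}\,d\xi\right)^{1/p}$. For nonnegative functions $f,g\in L^{p_\alpha}(\mathbb S^{2n+1})\setminus\{0\}$ put $$R(f,g)=\frac{\int_{\mathbb S^{2n+1}}\int_{\mathbb S^{2n+1}} f(\xi)\,g(\eta)\,|1-\xi\cdot\bar\eta|^{(\alpha-Q)/2}\,d\xi\,d\eta}{\|f\|_{p_\alpha}\,\|g\|_{p_\alpha}}\in[0,\infty],$$ and let $N_{Q,\alpha}=\inf R(f,g)$, the infimum over all such $f,g$ (the sharp constant of the reversed Hardy–Littlewood–Sobolev inequality on $\mathbb S^{2n+1}$). Let $|B_1|$ be the Lebesgue measure of the unit ball $B_1=\{(z,t)\in\mathbb C^n\times\mathbb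 R:\ (|z|^4+t^2)^{1/4}<1\}$ of the Heisenberg group. Then $$0<\frac{(8|B_1|)^{\frac{Q-\alpha}{Q}}}{2^{1+n\frac{\alpha-Q}{Q}}\,p_\alpha^2}\ \le\ N_{Q,\alpha}\ \le\ \Bigl(\frac{2\pi^{n+1}}{n!}\Bigr)^{\frac{Q-\alpha}{Q}}\frac{n!\,\Gamma(\alpha/2)}{\Gamma\bigl((Q+\alpha)/4\bigr)^2}.$$ Moreover, for every $\xi\in\mathbb S^{2n+1}$, $$\Bigl(\frac{2\pi^{n+1}}{n!}\Bigr)^{\frac{Q-\alpha}{Q}}\frac{n!\,\Gamma(\alpha/2)}{\Gamma\bigl((Q+\alpha)/4\bigr)^2}=|\mathbb S^{2n+1}|^{1-\frac{2}{p_\alpha}}\int_{\mathbb S^{2n+1}}|1-\xi\cdot\bar\eta|^{\frac{\alpha-Q}{2}}\,d\eta ,$$ and this number is the value of $R$ at every pair of positive constant functions. -/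

import Mathlib

open MeasureTheory
open scoped ENNReal

namespace CRSphere

noncomputable section

/-- Homogeneous dimension `Q = 2n + 2` of the Heisenberg group `ℍⁿ`. -/
def homDim (n : ℕ) : ℝ := 2 * n + 2

/-- The conformal exponent `p_α = 2Q / (Q + α)`. -/
def pExp (n : ℕ) (α : ℝ) : ℝ := 2 * homDim n / (homDim n + α)

/-- The norm `|(z,t)| = (|z|⁴ + t²)^{1/4}` on the Heisenberg group `ℍⁿ = ℂⁿ × ℝ`. -/
def heisenbergNorm {n : ℕ} (u : EuclideanSpace ℂ (Fin n) × ℝ) : ℝ :=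
  (‖u.1‖ ^ 4 + u.2 ^ 2) ^ (1 / 4 : ℝ)

/-- `|B₁|`: the Haar (Lebesgue) measure `dz dt` of the unit ball of `ℍⁿ` about the origin. -/
def volB1 (n : ℕ) : ℝ :=
  (volume : Measure (EuclideanSpace ℂ (Fin n) × ℝ)).real {u | heisenbergNorm u < 1}

/-- The unit sphere `𝕊^{2n+1}` of `ℂ^{n+1}`. -/
abbrev Sph (n : ℕ) : Type := Metric.sphere (0 : EuclideanSpace ℂ (Fin (n + 1))) 1

/-- The Euclidean surface measure on `𝕊^{2n+1}`. -/
def surf (n : ℕ) : Measure (Sph n) :=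
  (volume : Measure (EuclideanSpace ℂ (Fin (n + 1)))).toSphere

/-- `ξ · η̄ = ∑ⱼ ξⱼ η̄ⱼ`. -/
def hermDot {n : ℕ} (ξ η : Sph n) : ℂ :=
  ∑ j, ξ.1 j * (starRingEnd ℂ) (η.1 j)

/-- The kernel `|1 - ξ · η̄|^{(α - Q)/2}`. -/
def kern (n : ℕ) (α : ℝ) (ξ η : Sph n) : ℝ :=
  ‖1 - hermDot ξ η‖ ^ ((α - homDim n) / 2)

/-- The double integral `∫∫ f(ξ) g(η) |1 - ξ · η̄|^{(α - Q)/2} dξ dη ∈ [0, ∞]` of nonnegative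
functions `f, g`. It may be infinite, because `p_α < 1` when `α > Q`. -/
def energy (n : ℕ) (α : ℝ) (f g : Sph n → ℝ) : ℝ≥0∞ :=
  ∫⁻ ξ, ∫⁻ η, ENNReal.ofReal (f ξ * g η * kern n α ξ η) ∂(surf n) ∂(surf n)

/-- The quotient of the double integral and `‖f‖_{L^{p_α}} ‖g‖_{L^{p_α}}`, where
`‖f‖_{L^p} = (∫ |f|^p)^{1/p}` (also for `0 < p < 1`). -/
def hlsQuotient (n : ℕ) (α : ℝ) (f g : Sph n → ℝ) : ℝ≥0∞ :=
  energy n α f g /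
    (eLpNorm f (ENNReal.ofReal (pExp n α)) (surf n) *
      eLpNorm g (ENNReal.ofReal (pExp n α)) (surf n))

/-- Admissible functions: the nonnegative elements of `L^{p_α}(𝕊^{2n+1}) \ {0}`. -/
def Admissible (n : ℕ) (α : ℝ) (f : Sph n → ℝ) : Prop :=
  (∀ ξ, 0 ≤ f ξ) ∧ MemLp f (ENNReal.ofReal (pExp n α)) (surf n) ∧ ¬ f =ᵐ[surf n] 0

/-- The sharp constant `N_{Q,α}`: the infimum of the quotient over admissible pairs. -/
def sharpConst (n : ℕ) (α : ℝ) : ℝ≥0∞ :=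
  ⨅ (f : Sph n → ℝ) (g : Sph n → ℝ) (_ : Admissible n α f) (_ : Admissible n α g),
    hlsQuotient n α f g

/-- `(8|B₁|)^{(Q-α)/Q} / (2^{1 + n(α-Q)/Q} p_α²)`. -/
def lowerBound (n : ℕ) (α : ℝ) : ℝ :=
  (8 * volB1 n) ^ ((homDim n - α) / homDim n) /
    (2 ^ (1 + n * ((α - homDim n) / homDim n)) * pExp n α ^ 2)

/-- `(2π^{n+1}/n!)^{(Q-α)/Q} · n! Γ(α/2) / Γ((Q+α)/4)²`. -/
def upperBound (n : ℕ) (α : ℝ) : ℝ :=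
  (2 * Real.pi ^ (n + 1) / n.factorial) ^ ((homDim n - α) / homDim n) *
    (n.factorial * Real.Gamma (α / 2) / Real.Gamma ((homDim n + α) / 4) ^ 2)

end

end CRSphere

/-!
The idea is that the kernel is a power of `D(ξ, η) = |1 - ξ · η̄|`, and that the lower bound needs nothing
about `D` except its symmetry and the volume bound `|{η : D(ξ, η) < ρ}| ≤ 2ⁿ |B₁| ρ^{n+1}`. Write
`b = (α - Q)/2`, `μ = b/(n+1) = (α - Q)/Q` and `p = p_α`, so that `1/p = 1 + μ/2`.

*Lower bound* (`reversed_hls`). The bathtub principle turns the volume bound, with constant `K`, into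
`∫_A ∫_B D^b ≥ K^{-μ}/(1+μ) · |A| |B| max(|A|, |B|)^μ`. By the layer-cake formula the double integral is at
least `K^{-μ}/(1+μ)` times `∬ F(s) G(t) max(F(s), G(t))^μ ds dt`, where `F` and `G` are the distribution
functions of `f` and `g`. Split the heights at the points `τ`, `τ'` which halve `∫ s^{p-1} F` and
`∫ t^{p-1} G`. On `s < τ`, `t > τ'` use `F^μ` for the maximum, then Hölder's inequality in `s` and
monotonicity of `t^{p-1}` in `t`; on the opposite block exchange the roles. The two bounds carry inverse
powers of `τ/τ'`, so their sum is bounded below by the arithmetic-geometric mean inequality. Since no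
monotonicity of `F` and `G` is used, the same bound applies to the two remaining blocks, and the gain
(`layerEnergy_ge`) is enough for the stated constant, because `1 + μ ≤ 2^μ + 1/2`.

*Volume bound and kernel integral.* The variable `⟪ξ, η⟫` has the density
`2πⁿ/(n-1)! · (1 - |ζ|²)^{n-1}` on the unit disc (`lintegral_surf_inner`). In polar coordinates about the
boundary point, `ζ = 1 - r e^{iθ}`, one has `1 - |ζ|² = r (2 cos θ - r)` (`lintegral_disc_polar`). For the
kernel this gives a Beta integral in `r` and a power of the cosine in `θ`, which combine by the duplication
formula to the Gamma quotient in the upper bound. For the ball, `r (2 cos θ - r) ≤ 2 r cos θ` leaves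
`∫ cos^{n-1} θ dθ`, the same integral that appears in `|B₁|` when polar coordinates are used in the
variables `(|z|², t)` (`volume_heisenberg_ball`); this is why the volume of the Heisenberg ball enters.

The upper bound is the value of the quotient at constant functions.
-/

namespace CRSphere
open Set

/-! ### The reversed inequality for distribution functions -/

/-- `∫_{s>0} s^{p-1} F(s) ds`; for a distribution function `F(s) = ν{f > s}` it is
`(1/p) ∫ f^p dν`. -/
noncomputable def layerMass (p : ℝ) (F : ℝ → ℝ≥0∞) : ℝ≥0∞ :=
  ∫⁻ s in Ioi 0, ENNReal.ofReal (s ^ (p - 1)) * F s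

/-- The lower bound `∬_{s,t>0} F(s) G(t) max(F(s), G(t))^μ ds dt` for the double integral in terms of
the distribution functions. -/
noncomputable def layerEnergy (μ : ℝ) (F G : ℝ → ℝ≥0∞) : ℝ≥0∞ :=
  ∫⁻ s in Ioi 0, ∫⁻ t in Ioi 0, F s * G t * max (F s) (G t) ^ μ

lemma lintegral_rpow_Ioo {a τ : ℝ} (ha : 0 < a) (hτ : 0 ≤ τ) :
    ∫⁻ s in Ioo 0 τ, ENNReal.ofReal (s ^ (a - 1)) = ENNReal.ofReal (τ ^ a / a) := by
  rw [Measure.restrict_congr_set Ioo_ae_eq_Ioc, ← ofReal_integral_eq_lintegral_ofReal,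
    ← intervalIntegral.integral_of_le hτ, integral_rpow (Or.inl (by linarith))]
  · simp [Real.zero_rpow ha.ne']
  · exact (intervalIntegral.intervalIntegrable_rpow' (by linarith)).1
  · filter_upwards [ae_restrict_mem measurableSet_Ioc] with s hs
    exact Real.rpow_nonneg hs.1.le _

/-- Hölder's inequality on `(0, τ)` with exponents `1 + μ` and `(1 + μ)/μ`. The weight
`s^{(p-1)(1+μ)/μ} = s^{p/2-1}` is integrable at `0`. -/
lemma rpow_layerMass_Ioo_le {p μ : ℝ} (hp : 0 < p) (hμ : 0 < μ) (hpμ : p * (2 + μ) = 2)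
    {F : ℝ → ℝ≥0∞} (hF : Measurable F) {τ : ℝ} (hτ : 0 < τ) :
    (∫⁻ s in Ioo 0 τ, ENNReal.ofReal (s ^ (p - 1)) * F s) ^ (1 + μ) *
        ENNReal.ofReal ((p / 2) ^ μ * τ ^ (p - 1)) ≤ ∫⁻ s in Ioo 0 τ, F s ^ (1 + μ) := by
  have hq : (1 + μ).HolderConjugate ((1 + μ) / μ) := by
    rw [Real.holderConjugate_iff]
    refine ⟨by linarith, by field_simp⟩
  have key := ENNReal.lintegral_mul_le_Lp_mul_Lq (volume.restrict (Ioo 0 τ)) hq hF.aemeasurable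
    (g := fun s => ENNReal.ofReal (s ^ (p - 1))) (by fun_prop)
  have hw : ∫⁻ s in Ioo 0 τ, ENNReal.ofReal (s ^ (p - 1)) ^ ((1 + μ) / μ) =
      ENNReal.ofReal (τ ^ (p / 2) / (p / 2)) := by
    rw [← lintegral_rpow_Ioo (by positivity) hτ.le]
    refine setLIntegral_congr_fun measurableSet_Ioo fun s hs => ?_
    have h0 : 0 < s := hs.1
    rw [ENNReal.ofReal_rpow_of_pos (by positivity), ← Real.rpow_mul h0.le]
    congr 2
    field_simp
    nlinarith
  rw [hw] at key
  have hpos : 0 < τ ^ (p / 2) / (p / 2) := by positivity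
  have key2 := ENNReal.rpow_le_rpow key (z := 1 + μ) (by positivity)
  rw [ENNReal.mul_rpow_of_nonneg _ _ (by positivity : 0 ≤ 1 + μ), ← ENNReal.rpow_mul,
    ← ENNReal.rpow_mul, one_div_mul_cancel (by positivity), ENNReal.rpow_one,
    ENNReal.ofReal_rpow_of_pos hpos] at key2
  have e : ENNReal.ofReal ((τ ^ (p / 2) / (p / 2)) ^ (1 / ((1 + μ) / μ) * (1 + μ))) *
      ENNReal.ofReal ((p / 2) ^ μ * τ ^ (p - 1)) = 1 := by
    rw [← ENNReal.ofReal_mul (by positivity), ENNReal.ofReal_eq_one]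
    have : 1 / ((1 + μ) / μ) * (1 + μ) = μ := by field_simp
    rw [this, Real.div_rpow (by positivity) (by positivity), ← Real.rpow_mul hτ.le]
    have h2 : τ ^ (p / 2 * μ) * τ ^ (p - 1) = 1 := by
      rw [← Real.rpow_add hτ]
      have : p / 2 * μ + (p - 1) = 0 := by linarith
      rw [this, Real.rpow_zero]
    calc _ = τ ^ (p / 2 * μ) * τ ^ (p - 1) := by field_simp
      _ = 1 := h2
  calc _ = (∫⁻ a in Ioo 0 τ, (F * fun s => ENNReal.ofReal (s ^ (p - 1))) a) ^ (1 + μ) *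
        ENNReal.ofReal ((p / 2) ^ μ * τ ^ (p - 1)) := by
        simp only [Pi.mul_apply, mul_comm]
    _ ≤ _ := by
      grw [key2]
      rw [mul_assoc, e, mul_one]

lemma layerMass_Ioi_le {p : ℝ} (hp1 : p < 1) (G : ℝ → ℝ≥0∞) {τ : ℝ} (hτ : 0 < τ) :
    ENNReal.ofReal (τ ^ (1 - p)) * ∫⁻ s in Ioi τ, ENNReal.ofReal (s ^ (p - 1)) * G s ≤
      ∫⁻ s in Ioi τ, G s := by
  rw [← lintegral_const_mul' _ _ ENNReal.ofReal_ne_top]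
  refine setLIntegral_mono' measurableSet_Ioi fun s (hs : τ < s) => ?_
  rw [← mul_assoc, ← ENNReal.ofReal_mul (by positivity)]
  have h0 : 0 < s := hτ.trans hs
  have : τ ^ (1 - p) * s ^ (p - 1) ≤ 1 := by
    have h : s ^ (p - 1) = (s ^ (1 - p))⁻¹ := by rw [← Real.rpow_neg h0.le]; ring_nf
    rw [h, ← div_eq_mul_inv, div_le_one (by positivity)]
    exact Real.rpow_le_rpow hτ.le hs.le (by linarith)
  calc _ ≤ ENNReal.ofReal 1 * G s := by gcongr
    _ = G s := by simp

/-- The contribution of small heights of `F` and large heights of `G`. -/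
lemma layerEnergy_offDiag_ge {p μ : ℝ} (hp : 0 < p) (hμ : 0 < μ) (hpμ : p * (2 + μ) = 2)
    {F G : ℝ → ℝ≥0∞} (hF : Measurable F) (hG : Measurable G) {τ τ' : ℝ} (hτ : 0 < τ)
    (hτ' : 0 < τ') :
    ENNReal.ofReal ((p / 2) ^ μ * (τ ^ (p - 1) * τ' ^ (1 - p))) *
      ((∫⁻ s in Ioo 0 τ, ENNReal.ofReal (s ^ (p - 1)) * F s) ^ (1 + μ) *
        ∫⁻ t in Ioi τ', ENNReal.ofReal (t ^ (p - 1)) * G t) ≤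
      ∫⁻ s in Ioo 0 τ, ∫⁻ t in Ioi τ', F s * G t * max (F s) (G t) ^ μ := by
  have hp1 : p < 1 := by nlinarith
  calc _ = ((∫⁻ s in Ioo 0 τ, ENNReal.ofReal (s ^ (p - 1)) * F s) ^ (1 + μ) *
        ENNReal.ofReal ((p / 2) ^ μ * τ ^ (p - 1))) *
        (ENNReal.ofReal (τ' ^ (1 - p)) * ∫⁻ t in Ioi τ', ENNReal.ofReal (t ^ (p - 1)) * G t) := by
        rw [← mul_assoc ((p / 2) ^ μ), ENNReal.ofReal_mul (by positivity)]
        simp only [mul_comm, mul_left_comm, mul_assoc]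
    _ ≤ (∫⁻ s in Ioo 0 τ, F s ^ (1 + μ)) * ∫⁻ t in Ioi τ', G t := by
        gcongr
        · exact rpow_layerMass_Ioo_le hp hμ hpμ hF hτ
        · exact layerMass_Ioi_le hp1 G hτ'
    _ = ∫⁻ s in Ioo 0 τ, ∫⁻ t in Ioi τ', F s ^ (1 + μ) * G t := by
        rw [← lintegral_mul_const _ (by fun_prop)]
        simp_rw [lintegral_const_mul _ hG]
    _ ≤ _ := by
        refine lintegral_mono fun s => lintegral_mono fun t => ?_
        dsimp only
        rw [ENNReal.rpow_add_of_nonneg _ _ zero_le_one hμ.le, ENNReal.rpow_one]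
        calc _ = F s * G t * F s ^ μ := by ring
          _ ≤ _ := by gcongr; exact le_max_left _ _

lemma layerEnergy_comm (μ : ℝ) {F G : ℝ → ℝ≥0∞} (hF : Measurable F) (hG : Measurable G)
    (S T : Set ℝ) :
    ∫⁻ s in S, ∫⁻ t in T, F s * G t * max (F s) (G t) ^ μ =
      ∫⁻ t in T, ∫⁻ s in S, G t * F s * max (G t) (F s) ^ μ := by
  rw [lintegral_lintegral_swap (by fun_prop)]
  simp only [max_comm, mul_comm]

lemma exists_half_layerMass {p : ℝ} {F : ℝ → ℝ≥0∞} (hF : Measurable F) (h0 : layerMass p F ≠ 0)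
    (hfin : layerMass p F ≠ ∞) :
    ∃ τ : ℝ, 0 < τ ∧ ∫⁻ s in Ioo 0 τ, ENNReal.ofReal (s ^ (p - 1)) * F s = layerMass p F / 2 ∧
      ∫⁻ s in Ioi τ, ENNReal.ofReal (s ^ (p - 1)) * F s = layerMass p F / 2 := by
  let g : ℝ → ℝ≥0∞ := fun s => ENNReal.ofReal (s ^ (p - 1)) * F s
  have hgm : Measurable g := by fun_prop
  have hm : layerMass p F = ∫⁻ s in Ioi 0, g s := rfl
  have hint : IntegrableOn (fun s => (g s).toReal) (Ioi 0) :=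
    integrable_toReal_of_lintegral_ne_top hgm.aemeasurable hfin
  have hofReal : ∀ S, S ⊆ Ioi 0 → MeasurableSet S →
      ENNReal.ofReal (∫ s in S, (g s).toReal) = ∫⁻ s in S, g s := fun S hS _ => by
    have hlt : ∫⁻ s in S, g s ≠ ∞ := ne_top_of_le_ne_top hfin (lintegral_mono_set hS)
    rw [integral_toReal hgm.aemeasurable (ae_lt_top hgm hlt), ENNReal.ofReal_toReal hlt]
  have htot : ∫ s in Ioi 0, (g s).toReal = (layerMass p F).toReal := by
    rw [hm, ← hofReal _ subset_rfl measurableSet_Ioi,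
      ENNReal.toReal_ofReal (integral_nonneg fun _ => ENNReal.toReal_nonneg)]
  have hmpos : 0 < (layerMass p F).toReal := ENNReal.toReal_pos h0 hfin
  have hlim := intervalIntegral_tendsto_integral_Ioi 0 hint Filter.tendsto_id
  rw [htot] at hlim
  obtain ⟨X, hX, hX0⟩ := ((hlim.eventually (lt_mem_nhds (half_lt_self hmpos))).and
    (Filter.eventually_gt_atTop 0)).exists
  have hint' : IntegrableOn (fun s => (g s).toReal) (Icc 0 X) := by
    rw [integrableOn_Icc_iff_integrableOn_Ioc]
    exact hint.mono_set Ioc_subset_Ioi_self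
  obtain ⟨τ, hτ, hτe⟩ := intermediate_value_Icc hX0.le
    (intervalIntegral.continuousOn_primitive_interval (by rwa [uIcc_of_le hX0.le]) |>.mono
      (by rw [uIcc_of_le hX0.le]))
    (show (layerMass p F).toReal / 2 ∈ Icc _ _ by
      rw [intervalIntegral.integral_same]
      exact ⟨by positivity, hX.le⟩)
  have hτ0 : 0 < τ := by
    rcases hτ.1.eq_or_lt with h | h
    · rw [← h] at hτe
      simp only [intervalIntegral.integral_same] at hτe
      linarith
    · exact h
  dsimp only at hτe
  rw [intervalIntegral.integral_of_le hτ0.le] at hτe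
  have h1 : ∫⁻ s in Ioc 0 τ, g s = layerMass p F / 2 := by
    rw [← hofReal _ Ioc_subset_Ioi_self measurableSet_Ioc, hτe, ENNReal.ofReal_div_of_pos two_pos,
      ENNReal.ofReal_toReal hfin]
    simp
  refine ⟨τ, hτ0, by rw [Measure.restrict_congr_set Ioo_ae_eq_Ioc]; exact h1, ?_⟩
  have hsplit : layerMass p F = (∫⁻ s in Ioc 0 τ, g s) + ∫⁻ s in Ioi τ, g s := by
    rw [hm, ← lintegral_union measurableSet_Ioi (Ioc_disjoint_Ioi le_rfl),
      Ioc_union_Ioi_eq_Ioi hτ0.le]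
  rw [h1] at hsplit
  have hhalf : layerMass p F / 2 ≠ ∞ := ENNReal.div_ne_top hfin (by simp)
  refine (ENNReal.add_right_inj hhalf).1 ?_
  rw [← hsplit, ENNReal.add_halves]

lemma two_mul_rpow_le_add {u v x μ : ℝ} (hu : 0 < u) (hv : 0 < v) (hx : 0 < x) :
    2 * (u * v) ^ (1 + μ / 2) ≤ x * (u ^ (1 + μ) * v) + x⁻¹ * (v ^ (1 + μ) * u) := by
  have hw : ((u * v) ^ (1 + μ / 2)) ^ 2 = (x * (u ^ (1 + μ) * v)) * (x⁻¹ * (v ^ (1 + μ) * u)) := by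
    rw [← Real.rpow_natCast, ← Real.rpow_mul (by positivity)]
    have e : (1 + μ / 2) * (2 : ℕ) = (1 + μ) + 1 := by push_cast; ring
    rw [e, Real.rpow_add_one (by positivity), Real.mul_rpow hu.le hv.le]
    field_simp
  have h1 : 0 < x * (u ^ (1 + μ) * v) := by positivity
  have h2 : 0 < x⁻¹ * (v ^ (1 + μ) * u) := by positivity
  refine le_of_sq_le_sq ?_ (by positivity)
  nlinarith [sq_nonneg (x * (u ^ (1 + μ) * v) - x⁻¹ * (v ^ (1 + μ) * u))]

/-- At the half-mass heights `τ, τ'` the two off-diagonal blocks control the product of the masses: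
the powers of `τ / τ'` in `layerEnergy_offDiag_ge` and in its mirror image are inverse to each other,
so that they disappear in the arithmetic-geometric mean inequality. -/
lemma layerEnergy_offDiag_half_ge {p μ : ℝ} (hp : 0 < p) (hμ : 0 < μ) (hpμ : p * (2 + μ) = 2)
    {F G : ℝ → ℝ≥0∞} (hF : Measurable F) (hG : Measurable G) {τ τ' : ℝ} (hτ : 0 < τ)
    (hτ' : 0 < τ') {A B : ℝ} (hA : 0 < A) (hB : 0 < B)
    (hF₁ : ∫⁻ s in Ioo 0 τ, ENNReal.ofReal (s ^ (p - 1)) * F s = ENNReal.ofReal (A / 2))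
    (hF₂ : ∫⁻ s in Ioi τ, ENNReal.ofReal (s ^ (p - 1)) * F s = ENNReal.ofReal (A / 2))
    (hG₁ : ∫⁻ s in Ioo 0 τ', ENNReal.ofReal (s ^ (p - 1)) * G s = ENNReal.ofReal (B / 2))
    (hG₂ : ∫⁻ s in Ioi τ', ENNReal.ofReal (s ^ (p - 1)) * G s = ENNReal.ofReal (B / 2)) :
    ENNReal.ofReal (p ^ μ * 2 ^ (-1 - 2 * μ) * (A * B) ^ (1 + μ / 2)) ≤
      (∫⁻ s in Ioo 0 τ, ∫⁻ t in Ioi τ', F s * G t * max (F s) (G t) ^ μ) +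
        ∫⁻ s in Ioi τ, ∫⁻ t in Ioo 0 τ', F s * G t * max (F s) (G t) ^ μ := by
  have h1 := layerEnergy_offDiag_ge hp hμ hpμ hF hG hτ hτ'
  have h2 := layerEnergy_offDiag_ge hp hμ hpμ hG hF hτ' hτ
  rw [← layerEnergy_comm μ hF hG] at h2
  refine le_trans ?_ (add_le_add h1 h2)
  rw [hF₁, hF₂, hG₁, hG₂, ENNReal.ofReal_rpow_of_pos (by positivity),
    ENNReal.ofReal_rpow_of_pos (by positivity), ← ENNReal.ofReal_mul (by positivity),
    ← ENNReal.ofReal_mul (by positivity), ← ENNReal.ofReal_mul (by positivity),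
    ← ENNReal.ofReal_mul (by positivity), ← ENNReal.ofReal_add (by positivity) (by positivity)]
  refine ENNReal.ofReal_le_ofReal ?_
  have hx : τ' ^ (p - 1) * τ ^ (1 - p) = (τ ^ (p - 1) * τ' ^ (1 - p))⁻¹ := by
    rw [mul_inv, ← Real.rpow_neg hτ.le, ← Real.rpow_neg hτ'.le, neg_sub, neg_sub, mul_comm]
  rw [hx]
  have key := two_mul_rpow_le_add (μ := μ) (half_pos hA) (half_pos hB)
    (by positivity : 0 < τ ^ (p - 1) * τ' ^ (1 - p))
  have hc : p ^ μ * 2 ^ (-1 - 2 * μ) * (A * B) ^ (1 + μ / 2) =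
      (p / 2) ^ μ * (2 * (A / 2 * (B / 2)) ^ (1 + μ / 2)) := by
    have e : A / 2 * (B / 2) = A * B * 2 ^ (-2 : ℝ) := by
      rw [Real.rpow_neg zero_le_two, Real.rpow_two]; ring
    rw [e, Real.mul_rpow (x := A * B) (by positivity) (by positivity),
      ← Real.rpow_mul zero_le_two, Real.div_rpow hp.le zero_le_two]
    have e2 : (2 : ℝ) ^ (-1 - 2 * μ) = 2 * 2 ^ (-2 * (1 + μ / 2)) / 2 ^ μ := by
      rw [eq_div_iff (by positivity), ← Real.rpow_add two_pos]
      have h : (2 : ℝ) * 2 ^ (-2 * (1 + μ / 2)) = 2 ^ (1 + -2 * (1 + μ / 2)) := by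
        rw [Real.rpow_add two_pos, Real.rpow_one]
      rw [h]
      ring_nf
    rw [e2]
    ring
  rw [hc]
  calc _ ≤ (p / 2) ^ μ * _ := mul_le_mul_of_nonneg_left key (by positivity)
    _ = _ := by ring

/-- The four blocks cut out by the heights `τ` and `τ'`. -/
lemma layerEnergy_split (μ : ℝ) {F G : ℝ → ℝ≥0∞} (hF : Measurable F) (hG : Measurable G)
    {τ τ' : ℝ} (hτ : 0 < τ) (hτ' : 0 < τ') :
    layerEnergy μ F G =
      ((∫⁻ s in Ioo 0 τ, ∫⁻ t in Ioo 0 τ', F s * G t * max (F s) (G t) ^ μ) +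
        ∫⁻ s in Ioi τ, ∫⁻ t in Ioi τ', F s * G t * max (F s) (G t) ^ μ) +
      ((∫⁻ s in Ioo 0 τ, ∫⁻ t in Ioi τ', F s * G t * max (F s) (G t) ^ μ) +
        ∫⁻ s in Ioi τ, ∫⁻ t in Ioo 0 τ', F s * G t * max (F s) (G t) ^ μ) := by
  have hsp : ∀ {σ : ℝ} (_ : 0 < σ) (f : ℝ → ℝ≥0∞), ∫⁻ s in Ioi 0, f s =
      (∫⁻ s in Ioo 0 σ, f s) + ∫⁻ s in Ioi σ, f s := fun {σ} hσ f => by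
    rw [Measure.restrict_congr_set Ioo_ae_eq_Ioc,
      ← lintegral_union measurableSet_Ioi (Ioc_disjoint_Ioi le_rfl), Ioc_union_Ioi_eq_Ioi hσ.le]
  rw [layerEnergy, hsp hτ]
  simp_rw [hsp hτ']
  rw [lintegral_add_left (by fun_prop), lintegral_add_left (by fun_prop)]
  abel

lemma layerEnergy_indicator {μ : ℝ} {F G : ℝ → ℝ≥0∞} {S T : Set ℝ} (hS : MeasurableSet S)
    (hT : MeasurableSet T) (hS0 : S ⊆ Ioi 0) (hT0 : T ⊆ Ioi 0) :
    layerEnergy μ (S.indicator F) (T.indicator G) =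
      ∫⁻ s in S, ∫⁻ t in T, F s * G t * max (F s) (G t) ^ μ := by
  have hr : ∀ {U : Set ℝ} (_ : MeasurableSet U) (_ : U ⊆ Ioi 0) (f : ℝ → ℝ≥0∞),
      ∫⁻ s in U, f s = ∫⁻ s in Ioi 0, U.indicator f s := fun {U} hU hU0 f => by
    rw [lintegral_indicator hU, Measure.restrict_restrict hU, inter_eq_left.2 hU0]
  rw [hr hS hS0]
  simp_rw [hr hT hT0]
  refine lintegral_congr fun s => ?_
  by_cases hs : s ∈ S
  · simp only [indicator_of_mem hs]
    refine lintegral_congr fun t => ?_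
    by_cases ht : t ∈ T <;> simp [ht]
  · simp [hs]

lemma layerMass_indicator (p : ℝ) (F : ℝ → ℝ≥0∞) {S : Set ℝ} (hS : MeasurableSet S)
    (hS0 : S ⊆ Ioi 0) :
    layerMass p (S.indicator F) = ∫⁻ s in S, ENNReal.ofReal (s ^ (p - 1)) * F s := by
  rw [layerMass, ← inter_eq_left.2 hS0, ← Measure.restrict_restrict hS, ← lintegral_indicator hS,
    inter_eq_left.2 hS0]
  exact lintegral_congr fun s => by by_cases hs : s ∈ S <;> simp [hs]

lemma exists_half_heights {p : ℝ} {F : ℝ → ℝ≥0∞} (hF : Measurable F) {A : ℝ} (hA : 0 < A)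
    (hFA : layerMass p F = ENNReal.ofReal A) :
    ∃ τ : ℝ, 0 < τ ∧
      ∫⁻ s in Ioo 0 τ, ENNReal.ofReal (s ^ (p - 1)) * F s = ENNReal.ofReal (A / 2) ∧
      ∫⁻ s in Ioi τ, ENNReal.ofReal (s ^ (p - 1)) * F s = ENNReal.ofReal (A / 2) := by
  have := exists_half_layerMass hF (by rw [hFA]; simpa using hA) (by rw [hFA]; simp)
  rwa [hFA, ← ENNReal.ofReal_ofNat, ← ENNReal.ofReal_div_of_pos two_pos] at this

/-- The bound which only uses the off-diagonal blocks. -/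
lemma layerEnergy_ge_of_offDiag {p μ : ℝ} (hp : 0 < p) (hμ : 0 < μ) (hpμ : p * (2 + μ) = 2)
    {F G : ℝ → ℝ≥0∞} (hF : Measurable F) (hG : Measurable G) {A B : ℝ} (hA : 0 < A) (hB : 0 < B)
    (hFA : layerMass p F = ENNReal.ofReal A) (hGB : layerMass p G = ENNReal.ofReal B) :
    ENNReal.ofReal (p ^ μ * 2 ^ (-1 - 2 * μ) * (A * B) ^ (1 + μ / 2)) ≤ layerEnergy μ F G := by
  obtain ⟨τ, hτ, h1, h2⟩ := exists_half_heights hF hA hFA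
  obtain ⟨τ', hτ', h3, h4⟩ := exists_half_heights hG hB hGB
  rw [layerEnergy_split μ hF hG hτ hτ']
  exact le_add_left (layerEnergy_offDiag_half_ge hp hμ hpμ hF hG hτ hτ' hA hB h1 h2 h3 h4)

/-- The reversed inequality for the heights. The off-diagonal blocks alone give the constant
`p^μ 2^{-1-2μ}`; applying this bound again to the two diagonal blocks, whose masses are the halves,
gains the factor `1 + 2^{-1-μ}`. -/
lemma layerEnergy_ge {p μ : ℝ} (hp : 0 < p) (hμ : 0 < μ) (hpμ : p * (2 + μ) = 2)
    {F G : ℝ → ℝ≥0∞} (hF : Measurable F) (hG : Measurable G) {A B : ℝ} (hA : 0 < A) (hB : 0 < B)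
    (hFA : layerMass p F = ENNReal.ofReal A) (hGB : layerMass p G = ENNReal.ofReal B) :
    ENNReal.ofReal (p ^ μ * 2 ^ (-1 - 2 * μ) * (1 + 2 ^ (-1 - μ)) * (A * B) ^ (1 + μ / 2)) ≤
      layerEnergy μ F G := by
  obtain ⟨τ, hτ, h1, h2⟩ := exists_half_heights hF hA hFA
  obtain ⟨τ', hτ', h3, h4⟩ := exists_half_heights hG hB hGB
  have hsub : ∀ {σ : ℝ}, 0 < σ → Ioi σ ⊆ Ioi 0 := fun hσ => Ioi_subset_Ioi hσ.le
  rw [layerEnergy_split μ hF hG hτ hτ',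
    ← layerEnergy_indicator measurableSet_Ioo measurableSet_Ioo Ioo_subset_Ioi_self
      Ioo_subset_Ioi_self,
    ← layerEnergy_indicator measurableSet_Ioi measurableSet_Ioi (hsub hτ) (hsub hτ')]
  have d1 := layerEnergy_ge_of_offDiag hp hμ hpμ (hF.indicator (measurableSet_Ioo (a := 0) (b := τ)))
    (hG.indicator (measurableSet_Ioo (a := 0) (b := τ'))) (half_pos hA) (half_pos hB)
    (by rw [layerMass_indicator _ _ measurableSet_Ioo Ioo_subset_Ioi_self, h1])
    (by rw [layerMass_indicator _ _ measurableSet_Ioo Ioo_subset_Ioi_self, h3])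
  have d2 := layerEnergy_ge_of_offDiag hp hμ hpμ (hF.indicator (measurableSet_Ioi (a := τ)))
    (hG.indicator (measurableSet_Ioi (a := τ'))) (half_pos hA) (half_pos hB)
    (by rw [layerMass_indicator _ _ measurableSet_Ioi (hsub hτ), h2])
    (by rw [layerMass_indicator _ _ measurableSet_Ioi (hsub hτ'), h4])
  refine le_trans ?_ (add_le_add (add_le_add d1 d2)
    (layerEnergy_offDiag_half_ge hp hμ hpμ hF hG hτ hτ' hA hB h1 h2 h3 h4))
  rw [← ENNReal.ofReal_add (by positivity) (by positivity),
    ← ENNReal.ofReal_add (by positivity) (by positivity)]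
  refine ENNReal.ofReal_le_ofReal (le_of_eq ?_)
  have e : A / 2 * (B / 2) = A * B * 2 ^ (-2 : ℝ) := by
    rw [Real.rpow_neg zero_le_two, Real.rpow_two]; ring
  have e2 : (2 : ℝ) ^ (-1 - μ) = 2 * 2 ^ (-2 * (1 + μ / 2)) := by
    have h : (2 : ℝ) * 2 ^ (-2 * (1 + μ / 2)) = 2 ^ (1 + -2 * (1 + μ / 2)) := by
      rw [Real.rpow_add two_pos, Real.rpow_one]
    rw [h]
    ring_nf
  rw [e, Real.mul_rpow (x := A * B) (by positivity) (by positivity), ← Real.rpow_mul zero_le_two, e2]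
  ring

/-! ### The reversed Hardy–Littlewood–Sobolev inequality on a measure space -/

section Abstract

variable {X : Type*} [MeasurableSpace X] {ν : Measure X}

lemma lintegral_ofReal_mul_eq_layers {f : X → ℝ} (hf : Measurable f) (hf0 : ∀ x, 0 ≤ f x)
    {w : X → ℝ≥0∞} (hw : Measurable w) :
    ∫⁻ x, ENNReal.ofReal (f x) * w x ∂ν = ∫⁻ s in Ioi (0 : ℝ), ∫⁻ x in {x | s < f x}, w x ∂ν := by
  have h := lintegral_eq_lintegral_meas_lt (ν.withDensity w) (f := f)
    (Filter.Eventually.of_forall hf0) hf.aemeasurable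
  rw [lintegral_withDensity_eq_lintegral_mul _ hw (by fun_prop)] at h
  calc _ = _ := by simp only [Pi.mul_apply, mul_comm]
    _ = _ := h
    _ = _ := lintegral_congr fun s => withDensity_apply _ (measurableSet_lt measurable_const hf)

lemma lintegral_lintegral_eq_layers [SFinite ν] {f g : X → ℝ} (hf : Measurable f)
    (hf0 : ∀ x, 0 ≤ f x) (hg : Measurable g) (hg0 : ∀ x, 0 ≤ g x) {k : X → X → ℝ≥0∞}
    (hk : Measurable (Function.uncurry k)) :
    ∫⁻ x, ∫⁻ y, ENNReal.ofReal (f x) * ENNReal.ofReal (g y) * k x y ∂ν ∂ν =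
      ∫⁻ s in Ioi (0 : ℝ), ∫⁻ t in Ioi (0 : ℝ),
        ∫⁻ y in {y | t < g y}, ∫⁻ x in {x | s < f x}, k x y ∂ν ∂ν := by
  have hgk : Measurable (Function.uncurry fun x y => ENNReal.ofReal (g y) * k x y) := by
    unfold Function.uncurry
    fun_prop
  calc _ = ∫⁻ x, ENNReal.ofReal (f x) * ∫⁻ y, ENNReal.ofReal (g y) * k x y ∂ν ∂ν := by
        refine lintegral_congr fun x => ?_
        rw [← lintegral_const_mul _ (by fun_prop)]
        simp only [mul_assoc]
    _ = ∫⁻ s in Ioi (0 : ℝ), ∫⁻ x in {x | s < f x}, ∫⁻ y, ENNReal.ofReal (g y) * k x y ∂ν ∂ν :=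
        lintegral_ofReal_mul_eq_layers hf hf0 hgk.lintegral_prod_right
    _ = ∫⁻ s in Ioi (0 : ℝ), ∫⁻ y, ENNReal.ofReal (g y) * ∫⁻ x in {x | s < f x}, k x y ∂ν ∂ν := by
        refine lintegral_congr fun s => ?_
        rw [lintegral_lintegral_swap hgk.aemeasurable]
        refine lintegral_congr fun y => ?_
        rw [← lintegral_const_mul _ (by fun_prop)]
    _ = _ := lintegral_congr fun s =>
        lintegral_ofReal_mul_eq_layers hg hg0 (by fun_prop)

lemma integral_bathtub {b N M K R : ℝ} (hb : 0 < b) (hN : 0 < N) (hR : 0 < R)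
    (hKR : K * R ^ N = M) :
    ∫ t in 0..R, b * ((M - K * t ^ N) * t ^ (b - 1)) = M * R ^ b / (1 + b / N) := by
  have e : ∫ t in 0..R, b * ((M - K * t ^ N) * t ^ (b - 1)) =
      ∫ t in 0..R, (b * M * t ^ (b - 1) - b * K * t ^ (N + b - 1)) := by
    rw [intervalIntegral.integral_of_le hR.le, intervalIntegral.integral_of_le hR.le]
    refine setIntegral_congr_fun measurableSet_Ioc fun t ht => ?_
    have : t ^ (N + b - 1) = t ^ N * t ^ (b - 1) := by
      rw [← Real.rpow_add ht.1]; ring_nf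
    simp only [this]
    ring
  rw [e, intervalIntegral.integral_sub
    ((intervalIntegral.intervalIntegrable_rpow' (by linarith)).const_mul _)
    ((intervalIntegral.intervalIntegrable_rpow' (by linarith)).const_mul _),
    intervalIntegral.integral_const_mul, intervalIntegral.integral_const_mul,
    integral_rpow (Or.inl (by linarith)), integral_rpow (Or.inl (by linarith))]
  have h1 : R ^ (N + b - 1 + 1) = R ^ N * R ^ b := by rw [← Real.rpow_add hR]; ring_nf
  have h2 : N + b - 1 + 1 = N + b := by ring
  have h3 : b - 1 + 1 = b := by ring
  rw [h1, h2, h3, Real.zero_rpow hb.ne', Real.zero_rpow (by positivity), ← hKR]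
  have : N + b ≠ 0 := by positivity
  field_simp
  ring

/-- Bathtub principle: if the sublevel sets of `d` satisfy `ν {d < ρ} ≤ K ρ^N`, then the integral of
`d^b` over a set of given measure is at least what it would be if the set were a sublevel set `{d < R}`
with equality in this bound. -/
lemma rpow_measure_le_setLIntegral [IsFiniteMeasure ν] {d : X → ℝ} (hd : Measurable d)
    (hd0 : ∀ x, 0 ≤ d x) {b N K : ℝ} (hb : 0 < b) (hN : 0 < N) (hK : 0 < K)
    (hball : ∀ ρ : ℝ, 0 < ρ → ν {x | d x < ρ} ≤ ENNReal.ofReal (K * ρ ^ N)) (B : Set X) :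
    ENNReal.ofReal (K ^ (-(b / N)) / (1 + b / N)) * ν B ^ (1 + b / N) ≤
      ∫⁻ x in B, ENNReal.ofReal (d x ^ b) ∂ν := by
  set μ := b / N with hμ
  rcases eq_or_ne (ν B) 0 with h0 | h0
  · rw [h0, ENNReal.zero_rpow_of_pos (by positivity)]
    simp
  obtain ⟨M, hM, hMB⟩ : ∃ M : ℝ, 0 < M ∧ ν B = ENNReal.ofReal M :=
    ⟨(ν B).toReal, ENNReal.toReal_pos h0 (measure_ne_top _ _),
      (ENNReal.ofReal_toReal (measure_ne_top _ _)).symm⟩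
  -- The radius `R` at which the bound `K R^N` for the sublevel set equals the measure of `B`.
  set R : ℝ := (M / K) ^ (1 / N) with hRdef
  have hR : 0 < R := by positivity
  have hKR : K * R ^ N = M := by
    rw [hRdef, ← Real.rpow_mul (by positivity), one_div_mul_cancel hN.ne', Real.rpow_one]
    field_simp
  have hRb : R ^ b = M ^ μ * K ^ (-μ) := by
    rw [hRdef, ← Real.rpow_mul (by positivity), Real.rpow_neg hK.le, ← div_eq_mul_inv,
      ← Real.div_rpow hM.le hK.le, hμ]
    congr 1
    ring
  rw [lintegral_rpow_eq_lintegral_meas_le_mul _ (Filter.Eventually.of_forall hd0) hd.aemeasurable hb]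
  have hle : ∀ t : ℝ, 0 < t →
      ENNReal.ofReal (M - K * t ^ N) ≤ ν.restrict B {a | t ≤ d a} := fun t ht => by
    rw [ENNReal.ofReal_sub _ (by positivity), tsub_le_iff_right, ← hMB]
    calc ν B = ν.restrict B univ := by simp
      _ ≤ ν.restrict B ({a | t ≤ d a} ∪ {a | d a < t}) :=
          measure_mono fun a _ => le_or_gt t (d a)
      _ ≤ ν.restrict B {a | t ≤ d a} + ν.restrict B {a | d a < t} := measure_union_le _ _
      _ ≤ _ := by
          gcongr
          exact (Measure.restrict_apply_le _ _).trans (hball t ht)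
  calc _ = ENNReal.ofReal (∫ t in 0..R, b * ((M - K * t ^ N) * t ^ (b - 1))) := by
        rw [integral_bathtub hb hN hR hKR, hMB, ENNReal.ofReal_rpow_of_pos hM,
          ← ENNReal.ofReal_mul (by positivity), hRb, Real.rpow_add hM, Real.rpow_one]
        congr 1
        rw [← hμ]
        ring
    _ ≤ ∫⁻ t in Ioc 0 R, ENNReal.ofReal (b * ((M - K * t ^ N) * t ^ (b - 1))) := by
        rw [intervalIntegral.integral_of_le hR.le]
        -- A non-integrable integrand would have integral `0`, which is harmless here.
        by_cases hi : Integrable (fun t => b * ((M - K * t ^ N) * t ^ (b - 1)))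
            (volume.restrict (Ioc 0 R))
        · refine (ofReal_integral_eq_lintegral_ofReal hi ?_).le
          filter_upwards [ae_restrict_mem measurableSet_Ioc] with t ht
          have : K * t ^ N ≤ M := by
            rw [← hKR]
            exact mul_le_mul_of_nonneg_left (Real.rpow_le_rpow ht.1.le ht.2 hN.le) hK.le
          exact mul_nonneg hb.le (mul_nonneg (by linarith) (Real.rpow_nonneg ht.1.le _))
        · simp [integral_undef hi]
    _ ≤ ∫⁻ t in Ioi 0, ENNReal.ofReal (b * ((M - K * t ^ N) * t ^ (b - 1))) :=
        lintegral_mono_set Ioc_subset_Ioi_self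
    _ ≤ ∫⁻ t in Ioi 0, ENNReal.ofReal b *
          (ν.restrict B {a | t ≤ d a} * ENNReal.ofReal (t ^ (b - 1))) := by
        refine setLIntegral_mono' measurableSet_Ioi fun t (ht : 0 < t) => ?_
        rw [ENNReal.ofReal_mul hb.le, ENNReal.ofReal_mul' (by positivity)]
        gcongr
        exact hle t ht
    _ = _ := lintegral_const_mul' _ _ ENNReal.ofReal_ne_top

/-- The bathtub principle in both variables. -/
lemma mul_max_rpow_le_setLIntegral_setLIntegral [IsFiniteMeasure ν] {D : X → X → ℝ}
    (hD : Measurable (Function.uncurry D)) (hD0 : ∀ x y, 0 ≤ D x y) (hsymm : ∀ x y, D x y = D y x)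
    {b N K : ℝ} (hb : 0 < b) (hN : 0 < N) (hK : 0 < K)
    (hball : ∀ x, ∀ ρ : ℝ, 0 < ρ → ν {y | D x y < ρ} ≤ ENNReal.ofReal (K * ρ ^ N)) (A B : Set X) :
    ENNReal.ofReal (K ^ (-(b / N)) / (1 + b / N)) * (ν A * ν B * max (ν A) (ν B) ^ (b / N)) ≤
      ∫⁻ y in B, ∫⁻ x in A, ENNReal.ofReal (D x y ^ b) ∂ν ∂ν := by
  have hD' : Measurable fun z : X × X => D z.1 z.2 := hD
  have hμ0 : 0 < b / N := by positivity
  have key : ∀ A B : Set X, ENNReal.ofReal (K ^ (-(b / N)) / (1 + b / N)) *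
      (ν A * ν B * ν A ^ (b / N)) ≤
      ∫⁻ y in B, ∫⁻ x in A, ENNReal.ofReal (D x y ^ b) ∂ν ∂ν := fun A B => by
    have h : ∀ y, ENNReal.ofReal (K ^ (-(b / N)) / (1 + b / N)) * ν A ^ (1 + b / N) ≤
        ∫⁻ x in A, ENNReal.ofReal (D x y ^ b) ∂ν := fun y => by
      refine rpow_measure_le_setLIntegral (by fun_prop) (fun x => hD0 x y) hb hN hK ?_ A
      intro ρ hρ
      simpa only [hsymm y] using hball y ρ hρ
    calc _ = ∫⁻ _ in B, ENNReal.ofReal (K ^ (-(b / N)) / (1 + b / N)) * ν A ^ (1 + b / N) ∂ν := by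
          rw [setLIntegral_const, ENNReal.rpow_add_of_nonneg _ _ zero_le_one hμ0.le,
            ENNReal.rpow_one]
          ring
      _ ≤ _ := lintegral_mono h
  rcases le_total (ν A) (ν B) with h | h
  · rw [max_eq_right h, lintegral_lintegral_swap (by unfold Function.uncurry; fun_prop),
      mul_comm (ν A)]
    refine (key B A).trans_eq (lintegral_congr fun x => lintegral_congr fun y => ?_)
    rw [hsymm]
  · rw [max_eq_left h]
    exact key A B

lemma one_add_le_two_rpow_add {μ : ℝ} (hμ : 0 < μ) : 1 + μ ≤ 2 ^ μ + 1 / 2 := by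
  rcases le_total μ 1 with h | h
  · have h1 := Real.add_one_le_exp (Real.log 2 * μ)
    rw [Real.rpow_def_of_pos two_pos]
    nlinarith [Real.log_two_gt_d9]
  · have := one_add_mul_self_le_rpow_one_add (s := 1) (by norm_num) h
    norm_num at this
    linarith

/-- Reversed Hardy–Littlewood–Sobolev inequality on a finite measure space with a symmetric function
`D` whose sublevel sets satisfy `ν {D x < ρ} ≤ K ρ^N`. The hypothesis on `p` says
`1/p = 1 + b/(2N)`, the exponent for which the inequality is scale invariant. -/
theorem reversed_hls [IsFiniteMeasure ν] {D : X → X → ℝ}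
    (hD : Measurable (Function.uncurry D)) (hD0 : ∀ x y, 0 ≤ D x y) (hsymm : ∀ x y, D x y = D y x)
    {b N K p : ℝ} (hb : 0 < b) (hN : 0 < N) (hK : 0 < K) (hp : 0 < p) (hpμ : p * (2 + b / N) = 2)
    (hball : ∀ x, ∀ ρ : ℝ, 0 < ρ → ν {y | D x y < ρ} ≤ ENNReal.ofReal (K * ρ ^ N))
    {f g : X → ℝ} (hf : Measurable f) (hf0 : ∀ x, 0 ≤ f x) (hg : Measurable g) (hg0 : ∀ x, 0 ≤ g x)
    {P S : ℝ} (hP : 0 < P) (hS : 0 < S) (hfP : ∫⁻ x, ENNReal.ofReal (f x ^ p) ∂ν = ENNReal.ofReal P)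
    (hgS : ∫⁻ x, ENNReal.ofReal (g x ^ p) ∂ν = ENNReal.ofReal S) :
    ENNReal.ofReal ((8 * K) ^ (-(b / N)) / (2 * p ^ 2) * (P ^ (1 / p) * S ^ (1 / p))) ≤
      ∫⁻ x, ∫⁻ y, ENNReal.ofReal (f x * g y * D x y ^ b) ∂ν ∂ν := by
  have hD' : Measurable fun z : X × X => D z.1 z.2 := hD
  set μ := b / N with hμ
  have hμ0 : 0 < μ := by positivity
  set F : ℝ → ℝ≥0∞ := fun s => ν {x | s < f x} with hF
  set G : ℝ → ℝ≥0∞ := fun s => ν {x | s < g x} with hG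
  have hFm : Measurable F := Antitone.measurable fun s t hst => measure_mono fun x hx => hst.trans_lt hx
  have hGm : Measurable G := Antitone.measurable fun s t hst => measure_mono fun x hx => hst.trans_lt hx
  have hmass : ∀ {h : X → ℝ} (_ : Measurable h) (_ : ∀ x, 0 ≤ h x) {H : ℝ} (_ : 0 < H)
      (_ : ∫⁻ x, ENNReal.ofReal (h x ^ p) ∂ν = ENNReal.ofReal H),
      layerMass p (fun s => ν {x | s < h x}) = ENNReal.ofReal (H / p) := by
    intro h hh hh0 H hH he
    rw [lintegral_rpow_eq_lintegral_meas_lt_mul _ (Filter.Eventually.of_forall hh0)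
      hh.aemeasurable hp] at he
    rw [ENNReal.ofReal_div_of_pos hp, ENNReal.eq_div_iff (by simpa using hp) (by simp), ← he,
      layerMass]
    simp only [mul_comm]
  have key := layerEnergy_ge hp hμ0 hpμ hFm hGm (div_pos hP hp) (div_pos hS hp)
    (hmass hf hf0 hP hfP) (hmass hg hg0 hS hgS)
  have hlow : ENNReal.ofReal (K ^ (-μ) / (1 + μ)) * layerEnergy μ F G ≤
      ∫⁻ x, ∫⁻ y, ENNReal.ofReal (f x * g y * D x y ^ b) ∂ν ∂ν := by
    calc _ = ∫⁻ s in Ioi 0, ∫⁻ t in Ioi 0, ENNReal.ofReal (K ^ (-μ) / (1 + μ)) *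
          (F s * G t * max (F s) (G t) ^ μ) := by
          rw [layerEnergy, ← lintegral_const_mul' _ _ ENNReal.ofReal_ne_top]
          refine lintegral_congr fun s => ?_
          rw [lintegral_const_mul' _ _ ENNReal.ofReal_ne_top]
      _ ≤ ∫⁻ s in Ioi (0 : ℝ), ∫⁻ t in Ioi (0 : ℝ),
          ∫⁻ y in {y | t < g y}, ∫⁻ x in {x | s < f x}, ENNReal.ofReal (D x y ^ b) ∂ν ∂ν :=
          lintegral_mono fun s => lintegral_mono fun t =>
            mul_max_rpow_le_setLIntegral_setLIntegral hD hD0 hsymm hb hN hK hball _ _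
      _ = ∫⁻ x, ∫⁻ y, ENNReal.ofReal (f x) * ENNReal.ofReal (g y) *
            ENNReal.ofReal (D x y ^ b) ∂ν ∂ν :=
          (lintegral_lintegral_eq_layers hf hf0 hg hg0
            (k := fun x y => ENNReal.ofReal (D x y ^ b)) (by unfold Function.uncurry; fun_prop)).symm
      _ = _ := by
          refine lintegral_congr fun x => lintegral_congr fun y => ?_
          rw [ENNReal.ofReal_mul (mul_nonneg (hf0 x) (hg0 y)), ENNReal.ofReal_mul (hf0 x)]
  refine le_trans ?_ hlow
  refine le_trans ?_ (mul_le_mul_right key _)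
  rw [← ENNReal.ofReal_mul (by positivity)]
  refine ENNReal.ofReal_le_ofReal ?_
  have hexp : 1 + μ / 2 = 1 / p := by field_simp; linarith
  have e1 : (P / p * (S / p)) ^ (1 + μ / 2) = P ^ (1 / p) * S ^ (1 / p) * p ^ (-(2 + μ)) := by
    have : P / p * (S / p) = P * S * p ^ (-2 : ℝ) := by
      rw [Real.rpow_neg hp.le, Real.rpow_two]; field_simp
    rw [this, Real.mul_rpow (by positivity) (by positivity), Real.mul_rpow hP.le hS.le, hexp,
      ← hexp, ← Real.rpow_mul hp.le]
    ring_nf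
  have e2 : p ^ μ * p ^ (-(2 + μ)) = 1 / p ^ 2 := by
    rw [← Real.rpow_add hp, one_div, ← Real.rpow_two, ← Real.rpow_neg hp.le]
    ring_nf
  have e8 : (8 * K : ℝ) ^ (-μ) = 2 ^ (-(3 * μ)) * K ^ (-μ) := by
    rw [Real.mul_rpow (by norm_num) hK.le, show (8 : ℝ) = 2 ^ (3 : ℝ) by norm_num,
      ← Real.rpow_mul zero_le_two]
    ring_nf
  have e3 : (2 : ℝ) ^ (-1 - 2 * μ) * (1 + 2 ^ (-1 - μ)) =
      2 ^ (-(3 * μ)) * ((2 ^ μ + 1 / 2) / 2) := by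
    have a1 : (2 : ℝ) ^ (-1 - 2 * μ) = 2 ^ (-(3 * μ)) * 2 ^ μ / 2 := by
      rw [← Real.rpow_add two_pos, eq_div_iff two_ne_zero, ← Real.rpow_add_one two_ne_zero]
      ring_nf
    have a2 : (2 : ℝ) ^ (-1 - μ) * 2 ^ μ = 1 / 2 := by
      rw [← Real.rpow_add two_pos, show -1 - μ + μ = -1 by ring, Real.rpow_neg_one]
      norm_num
    rw [a1]
    linear_combination (2 ^ (-(3 * μ)) / 2 : ℝ) * a2
  -- The gain from the diagonal blocks absorbs the loss `1 / (1 + μ)` of the bathtub principle.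
  have hfac : 1 ≤ (2 ^ μ + 1 / 2) / (1 + μ) := by
    rw [one_le_div (by positivity)]
    exact one_add_le_two_rpow_add hμ0
  rw [e8, e1]
  calc _ = 2 ^ (-(3 * μ)) * K ^ (-μ) / (2 * p ^ 2) * (P ^ (1 / p) * S ^ (1 / p)) * 1 := by ring
    _ ≤ 2 ^ (-(3 * μ)) * K ^ (-μ) / (2 * p ^ 2) * (P ^ (1 / p) * S ^ (1 / p)) *
        ((2 ^ μ + 1 / 2) / (1 + μ)) := mul_le_mul_of_nonneg_left hfac (by positivity)
    _ = K ^ (-μ) / (1 + μ) * ((2 ^ (-(3 * μ)) * ((2 ^ μ + 1 / 2) / 2)) *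
        (P ^ (1 / p) * S ^ (1 / p)) * (1 / p ^ 2)) := by
        field_simp
    _ = _ := by
        rw [← e3, ← e2]
        ring

end Abstract

/-! ### Integration over the sphere of functions of one complex coordinate -/

lemma lintegral_eq_lintegral_comp_smul {E : Type*} [NormedAddCommGroup E] [NormedSpace ℝ E]
    [MeasurableSpace E] [BorelSpace E] [FiniteDimensional ℝ E] (ν : Measure E) [ν.IsAddHaarMeasure]
    {a : ℝ} (ha : 0 < a) {f : E → ℝ≥0∞} (hf : Measurable f) :
    ∫⁻ x, f x ∂ν = ENNReal.ofReal (a ^ Module.finrank ℝ E) * ∫⁻ x, f (a • x) ∂ν := by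
  rw [← lintegral_map (f := f) (g := fun x : E => a • x) hf (by fun_prop),
    Measure.map_addHaar_smul ν ha.ne', lintegral_smul_measure, smul_eq_mul, ← mul_assoc,
    ← ENNReal.ofReal_mul (by positivity), abs_of_pos (by positivity),
    mul_inv_cancel₀ (by positivity), ENNReal.ofReal_one, one_mul]

lemma finrank_real_euclideanSpace_complex (m : ℕ) :
    Module.finrank ℝ (EuclideanSpace ℂ (Fin m)) = 2 * m := by
  rw [← Module.finrank_mul_finrank ℝ ℂ]
  simp

lemma volume_norm_sq_lt {m : ℕ} (hm : 1 ≤ m) {r : ℝ} (hr : 0 ≤ r) :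
    volume {y : EuclideanSpace ℂ (Fin m) | ‖y‖ ^ 2 < r} =
      ENNReal.ofReal (Real.pi ^ m / m.factorial * r ^ m) := by
  have : Nonempty (Fin m) := ⟨⟨0, hm⟩⟩
  have hset : {y : EuclideanSpace ℂ (Fin m) | ‖y‖ ^ 2 < r} = Metric.ball 0 (√r) := by
    ext y
    simp [Real.lt_sqrt (norm_nonneg y)]
  rw [hset, InnerProductSpace.volume_ball_of_dim_even (finrank_real_euclideanSpace_complex m),
    finrank_real_euclideanSpace_complex, ← ENNReal.ofReal_pow (Real.sqrt_nonneg r), pow_mul,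
    Real.sq_sqrt hr, ← ENNReal.ofReal_mul (by positivity), mul_comm]

/-- Polar coordinates in `ℂ^m`, with the squared radius as the variable. -/
lemma lintegral_norm_sq {m : ℕ} (hm : 1 ≤ m) {k : ℝ → ℝ≥0∞} (hk : Measurable k) :
    ∫⁻ y : EuclideanSpace ℂ (Fin m), k (‖y‖ ^ 2) =
      ENNReal.ofReal (Real.pi ^ m / (m - 1).factorial) *
        ∫⁻ u in Ioi (0 : ℝ), k u * ENNReal.ofReal (u ^ (m - 1)) := by
  set c : ℝ := Real.pi ^ m / (m - 1).factorial with hc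
  have hc0 : 0 < c := by positivity
  set d : ℝ → ℝ≥0∞ := fun u => ENNReal.ofReal (u ^ (m - 1)) with hd
  have hdm : Measurable d := by fun_prop
  have hcd : (m.factorial : ℝ) = m * (m - 1).factorial := by
    exact_mod_cast (Nat.mul_factorial_pred (by omega)).symm
  have hm0 : (0 : ℝ) < m := by exact_mod_cast hm
  have hL : ∀ r : ℝ, Measure.map (fun y : EuclideanSpace ℂ (Fin m) => ‖y‖ ^ 2) volume (Iio r) =
      ENNReal.ofReal (c / m * max r 0 ^ m) := fun r => by
    rw [Measure.map_apply (by fun_prop) measurableSet_Iio]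
    rcases le_total 0 r with h | h
    · rw [max_eq_left h]
      have := volume_norm_sq_lt hm h
      rw [hcd] at this
      refine this.trans ?_
      congr 1
      rw [hc]
      field_simp
    · have : (fun y : EuclideanSpace ℂ (Fin m) => ‖y‖ ^ 2) ⁻¹' Iio r = ∅ := by
        ext y
        simp only [mem_preimage, mem_Iio, mem_empty_iff_false, iff_false, not_lt]
        exact h.trans (sq_nonneg _)
      rw [this, max_eq_right h, zero_pow (by omega)]
      simp
  have hR : ∀ r : ℝ, (ENNReal.ofReal c • (volume.restrict (Ioi 0)).withDensity d) (Iio r) =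
      ENNReal.ofReal (c / m * max r 0 ^ m) := fun r => by
    rw [Measure.smul_apply, withDensity_apply _ measurableSet_Iio,
      Measure.restrict_restrict measurableSet_Iio, Iio_inter_Ioi]
    rcases le_total 0 r with h | h
    · have := lintegral_rpow_Ioo hm0 h
      have e : ∫⁻ u in Ioo 0 r, d u = ENNReal.ofReal (r ^ (m : ℝ) / m) := by
        rw [← this]
        refine setLIntegral_congr_fun measurableSet_Ioo fun u _ => ?_
        rw [← Nat.cast_pred (by omega), Real.rpow_natCast]
      rw [e, smul_eq_mul, ← ENNReal.ofReal_mul hc0.le, max_eq_left h, Real.rpow_natCast]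
      congr 1
      ring
    · rw [Ioo_eq_empty (by simpa using h), max_eq_right h, zero_pow (by omega)]
      simp
  have hmeas : Measure.map (fun y : EuclideanSpace ℂ (Fin m) => ‖y‖ ^ 2) volume =
      ENNReal.ofReal c • (volume.restrict (Ioi 0)).withDensity d := by
    refine Measure.ext_of_generateFrom_of_iUnion (range Iio) (fun i : ℕ => Iio (i : ℝ))
      (BorelSpace.measurable_eq.trans (borel_eq_generateFrom_Iio ℝ)) isPiSystem_Iio ?_ ?_ ?_ ?_
    · exact iUnion_eq_univ_iff.2 fun x => exists_nat_gt x
    · exact fun i => mem_range_self _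
    · intro i
      rw [hL]
      exact ENNReal.ofReal_ne_top
    · rintro _ ⟨r, rfl⟩
      rw [hL, hR]
  rw [← lintegral_map (f := k) hk (by fun_prop), hmeas, lintegral_smul_measure,
    lintegral_withDensity_eq_lintegral_mul _ hdm hk, smul_eq_mul]
  simp only [Pi.mul_apply, mul_comm, hd]

/-- The isometry `ℂ^{n+1} ≃ ℂ × ℂ^n` which splits off the first coordinate, over the reals. -/
noncomputable def consIsometry (n : ℕ) :
    EuclideanSpace ℂ (Fin (n + 1)) ≃ₗᵢ[ℝ] WithLp 2 (ℂ × EuclideanSpace ℂ (Fin n)) where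
  toFun x := WithLp.toLp 2 (x 0, WithLp.toLp 2 fun i => x i.succ)
  invFun w := WithLp.toLp 2 (Fin.cons w.fst fun i => w.snd i)
  map_add' x y := rfl
  map_smul' c x := rfl
  left_inv x := by
    ext i
    refine Fin.cases ?_ (fun j => ?_) i <;> simp
  right_inv w := rfl
  norm_map' x := by
    change ‖(WithLp.toLp 2 (x 0, WithLp.toLp 2 fun i => x i.succ) :
      WithLp 2 (ℂ × EuclideanSpace ℂ (Fin n)))‖ = ‖x‖
    simp [WithLp.prod_norm_eq_of_L2, EuclideanSpace.norm_eq, Fin.sum_univ_succ,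
      Real.sq_sqrt (Finset.sum_nonneg fun _ _ => sq_nonneg _)]

/-- A real isometry of `ℂ^{n+1}` onto `ℂ × ℂ^n` whose first component is `⟪ξ, ·⟫`. -/
lemma exists_isometry_inner {n : ℕ} (ξ : Sph n) :
    ∃ L : EuclideanSpace ℂ (Fin (n + 1)) ≃ₗᵢ[ℝ] WithLp 2 (ℂ × EuclideanSpace ℂ (Fin n)),
      ∀ x, (L x).fst = inner ℂ ξ.1 x := by
  have hξ : ‖ξ.1‖ = 1 := by simp
  obtain ⟨b, hb⟩ := Orthonormal.exists_orthonormalBasis_extension_of_card_eq (𝕜 := ℂ)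
    (E := EuclideanSpace ℂ (Fin (n + 1))) (ι := Fin (n + 1)) (by simp) (v := fun _ => ξ.1)
    (s := {0}) ⟨fun _ => hξ, fun i j hij => absurd (Subsingleton.elim i j) hij⟩
  refine ⟨LinearIsometryEquiv.trans
    ⟨b.repr.toLinearEquiv.restrictScalars ℝ, b.repr.norm_map⟩ (consIsometry n), fun x => ?_⟩
  have : b.repr x 0 = inner ℂ ξ.1 x := by rw [b.repr_apply_apply, hb 0 rfl]
  exact this

lemma lintegral_inner_norm_sq {n : ℕ} (ξ : Sph n) {H : ℂ → ℝ → ℝ≥0∞}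
    (hH : Measurable (Function.uncurry H)) :
    ∫⁻ x : EuclideanSpace ℂ (Fin (n + 1)), H (inner ℂ ξ.1 x) (‖x‖ ^ 2) =
      ∫⁻ z : ℂ, ∫⁻ y : EuclideanSpace ℂ (Fin n), H z (‖z‖ ^ 2 + ‖y‖ ^ 2) := by
  obtain ⟨L, hL⟩ := exists_isometry_inner ξ
  have hH' : Measurable fun z : ℂ × ℝ => H z.1 z.2 := hH
  have hmp := (WithLp.volume_preserving_ofLp ℂ (EuclideanSpace ℂ (Fin n))).comp L.measurePreserving
  have h := hmp.lintegral_comp (f := fun w : ℂ × EuclideanSpace ℂ (Fin n) =>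
    H w.1 (‖w.1‖ ^ 2 + ‖w.2‖ ^ 2)) (by fun_prop)
  rw [Measure.volume_eq_prod, lintegral_prod _ (by fun_prop)] at h
  rw [← h]
  refine lintegral_congr fun x => ?_
  have e : ‖x‖ ^ 2 = ‖(L x).fst‖ ^ 2 + ‖(L x).snd‖ ^ 2 := by
    rw [← L.norm_map x, WithLp.prod_norm_sq_eq_of_L2]
  rw [e, ← hL x]
  rfl

/-- Polar coordinates in `ℂ^{n+1}` for functions of one complex coordinate and of the squared
radius `v`. -/
lemma lintegral_inner_norm_sq_eq_disc {n : ℕ} (hn : 1 ≤ n) (ξ : Sph n) {H : ℂ → ℝ → ℝ≥0∞}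
    (hH : Measurable (Function.uncurry H)) :
    ∫⁻ x : EuclideanSpace ℂ (Fin (n + 1)), H (inner ℂ ξ.1 x) (‖x‖ ^ 2) =
      ENNReal.ofReal (Real.pi ^ n / (n - 1).factorial) *
        ∫⁻ v in Ioi (0 : ℝ), ENNReal.ofReal (v ^ n) *
          ∫⁻ ζ in Metric.ball (0 : ℂ) 1, H (√v * ζ) v *
            ENNReal.ofReal ((1 - ‖ζ‖ ^ 2) ^ (n - 1)) := by
  have hH' : Measurable fun z : ℂ × ℝ => H z.1 z.2 := hH
  -- With `v = |z|² + u`, where `u` is the squared norm of the other coordinates, the integral is that of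
  -- `J` over all `(z, v)`; for fixed `v` the substitution `z = √v ζ` leads to the unit disc.
  set J : ℂ → ℝ → ℝ≥0∞ := fun z v => (Ioi (‖z‖ ^ 2)).indicator
    (fun v => H z v * ENNReal.ofReal ((v - ‖z‖ ^ 2) ^ (n - 1))) v with hJ
  have hJm : Measurable (Function.uncurry J) := by
    have : Function.uncurry J = {w : ℂ × ℝ | ‖w.1‖ ^ 2 < w.2}.indicator
      (fun w => H w.1 w.2 * ENNReal.ofReal ((w.2 - ‖w.1‖ ^ 2) ^ (n - 1))) := by
      ext ⟨z, v⟩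
      simp [hJ, Function.uncurry, indicator]
    rw [this]
    refine Measurable.indicator (by fun_prop) (measurableSet_lt (by fun_prop) (by fun_prop))
  have h1 : ∀ z : ℂ, ∫⁻ u in Ioi (0 : ℝ), H z (‖z‖ ^ 2 + u) * ENNReal.ofReal (u ^ (n - 1)) =
      ∫⁻ v, J z v := fun z => by
    rw [← lintegral_indicator measurableSet_Ioi, ← lintegral_add_left_eq_self (J z) (‖z‖ ^ 2)]
    refine lintegral_congr fun u => ?_
    simp [hJ, indicator]
  have h2 : ∀ v : ℝ, v ≤ 0 → ∫⁻ z, J z v = 0 := fun v hv => by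
    rw [← lintegral_zero (μ := (volume : Measure ℂ))]
    refine lintegral_congr fun z => ?_
    refine indicator_of_notMem (fun h : ‖z‖ ^ 2 < v => ?_) _
    have := sq_nonneg ‖z‖
    linarith
  have h3 : ∀ v : ℝ, 0 < v → ∫⁻ z, J z v = ENNReal.ofReal (v ^ n) *
      ∫⁻ ζ in Metric.ball (0 : ℂ) 1, H (√v * ζ) v * ENNReal.ofReal ((1 - ‖ζ‖ ^ 2) ^ (n - 1)) := by
    intro v hv
    have hs : 0 < √v := Real.sqrt_pos.2 hv
    have hsc : ∫⁻ z, J z v = ENNReal.ofReal v * ∫⁻ ζ : ℂ, J (√v • ζ) v := by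
      rw [lintegral_eq_lintegral_comp_smul volume hs (f := fun z => J z v) (by fun_prop),
        Complex.finrank_real_complex, Real.sq_sqrt hv.le]
    rw [hsc, ← lintegral_const_mul' _ _ ENNReal.ofReal_ne_top,
      ← lintegral_const_mul' _ _ ENNReal.ofReal_ne_top,
      ← lintegral_indicator Metric.isOpen_ball.measurableSet]
    refine lintegral_congr fun ζ => ?_
    have hnorm : ‖√v • ζ‖ ^ 2 = v * ‖ζ‖ ^ 2 := by
      rw [norm_smul, mul_pow, Real.norm_of_nonneg hs.le, Real.sq_sqrt hv.le]
    by_cases hζ : ‖ζ‖ < 1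
    · have hlt : ‖√v • ζ‖ ^ 2 < v := by
        rw [hnorm]
        have : ‖ζ‖ ^ 2 < 1 := by nlinarith [norm_nonneg ζ]
        nlinarith
      rw [indicator_of_mem (by simpa using hζ)]
      simp only [hJ]
      rw [indicator_of_mem (mem_Ioi.2 hlt), hnorm]
      have e : (v - v * ‖ζ‖ ^ 2) ^ (n - 1) = v ^ (n - 1) * (1 - ‖ζ‖ ^ 2) ^ (n - 1) := by
        rw [← mul_pow]; ring
      have e2 : v ^ n = v * v ^ (n - 1) := by rw [← pow_succ', Nat.sub_add_cancel hn]
      rw [e, e2, ENNReal.ofReal_mul (by positivity), ENNReal.ofReal_mul (by positivity),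
        Complex.real_smul]
      ring
    · have hlt : ¬ ‖√v • ζ‖ ^ 2 < v := by
        rw [hnorm]
        have : 1 ≤ ‖ζ‖ ^ 2 := by nlinarith [norm_nonneg ζ]
        nlinarith
      rw [indicator_of_notMem (by simpa using hζ)]
      simp only [hJ]
      rw [indicator_of_notMem (fun h => hlt (mem_Ioi.1 h)), mul_zero]
  rw [lintegral_inner_norm_sq ξ hH]
  calc _ = ∫⁻ z : ℂ, ENNReal.ofReal (Real.pi ^ n / (n - 1).factorial) * ∫⁻ v, J z v := by
        refine lintegral_congr fun z => ?_
        rw [lintegral_norm_sq hn (k := fun u => H z (‖z‖ ^ 2 + u)) (by fun_prop), h1]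
    _ = ENNReal.ofReal (Real.pi ^ n / (n - 1).factorial) * ∫⁻ v, ∫⁻ z : ℂ, J z v := by
        rw [lintegral_const_mul' _ _ ENNReal.ofReal_ne_top, lintegral_lintegral_swap hJm.aemeasurable]
    _ = _ := by
        congr 1
        rw [← lintegral_indicator measurableSet_Ioi]
        refine lintegral_congr fun v => ?_
        by_cases hv : 0 < v
        · rw [indicator_of_mem (by exact hv), h3 v hv]
        · rw [indicator_of_notMem (by exact hv), h2 v (not_lt.1 hv)]

/-- Integration over the unit ball of a function which is homogeneous of degree `0`. -/
lemma lintegral_ball_homogeneous {n : ℕ} {w : Sph n → ℝ≥0∞} (hw : Measurable w)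
    {W : EuclideanSpace ℂ (Fin (n + 1)) → ℝ≥0∞} (hW : ∀ η : Sph n, ∀ r : ℝ, 0 < r →
      W (r • η.1) = (Iio 1).indicator (fun _ => w η) r) :
    ∫⁻ x, W x = ENNReal.ofReal (1 / (2 * (n + 1))) * ∫⁻ η, w η ∂(surf n) := by
  have hmp := Measure.measurePreserving_homeomorphUnitSphereProd
    (volume : Measure (EuclideanSpace ℂ (Fin (n + 1))))
  have h1 : ∫⁻ x, W x = ∫⁻ x : ({(0)}ᶜ : Set (EuclideanSpace ℂ (Fin (n + 1)))), W x.1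
      ∂((volume : Measure (EuclideanSpace ℂ (Fin (n + 1)))).comap (↑)) := by
    rw [lintegral_subtype_comap (measurableSet_singleton _).compl, restrict_compl_singleton]
  have h2 := hmp.lintegral_comp_emb (Homeomorph.measurableEmbedding _)
    (fun q => W (q.2.1 • q.1.1))
  have h3 : ∀ x : ({(0)}ᶜ : Set (EuclideanSpace ℂ (Fin (n + 1)))),
      W (((homeomorphUnitSphereProd _ x).2 : ℝ) •
      ((homeomorphUnitSphereProd _ x).1 : EuclideanSpace ℂ (Fin (n + 1)))) = W x.1 := fun x => by
    rw [← homeomorphUnitSphereProd_symm_apply_coe, Homeomorph.symm_apply_apply]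
  simp only [h3] at h2
  rw [h1, h2]
  have h4 : ∀ q : Sph n × Ioi (0 : ℝ), W (q.2.1 • q.1.1) =
      w q.1 * (Iio (⟨1, mem_Ioi.2 one_pos⟩ : Ioi (0 : ℝ))).indicator (fun _ => 1) q.2 := fun q => by
    rw [hW q.1 q.2.1 q.2.2]
    simp only [indicator, mem_Iio, ← Subtype.coe_lt_coe]
    split_ifs <;> simp
  simp only [h4]
  rw [lintegral_prod_mul hw.aemeasurable
      (measurable_const.indicator measurableSet_Iio).aemeasurable,
    lintegral_indicator measurableSet_Iio,
    setLIntegral_const, Measure.volumeIoiPow_apply_Iio, mul_comm, finrank_real_euclideanSpace_complex]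
  congr 1
  rw [one_mul, one_pow, Nat.cast_pred (by omega)]
  push_cast
  ring_nf

/-- The image of the surface measure under one complex coordinate has the density
`(2πⁿ/(n-1)!) (1 - |ζ|²)^{n-1}` on the unit disc. Both sides are, up to a constant, the integral over
the unit ball of `ℂ^{n+1}` of the extension of the function that is homogeneous of degree `0`. -/
theorem lintegral_surf_inner {n : ℕ} (hn : 1 ≤ n) (ξ : Sph n) {h : ℂ → ℝ≥0∞} (hh : Measurable h) :
    ∫⁻ η, h (inner ℂ ξ.1 η.1) ∂(surf n) =
      ENNReal.ofReal (2 * Real.pi ^ n / (n - 1).factorial) *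
        ∫⁻ ζ in Metric.ball (0 : ℂ) 1, h ζ * ENNReal.ofReal ((1 - ‖ζ‖ ^ 2) ^ (n - 1)) := by
  -- The extension of `h ⟪ξ, ·⟫` to the unit ball, homogeneous of degree `0`, in terms of the coordinate
  -- `z = ⟪ξ, x⟫` and of `v = |x|²`.
  set H : ℂ → ℝ → ℝ≥0∞ := fun z v => (Iio (1 : ℝ)).indicator (fun _ => h ((√v : ℂ)⁻¹ * z)) v with hHdef
  have hH : Measurable (Function.uncurry H) := by
    have : Function.uncurry H = {w : ℂ × ℝ | w.2 < 1}.indicator (fun w => h ((√w.2 : ℂ)⁻¹ * w.1)) := by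
      ext ⟨z, v⟩
      simp [hHdef, Function.uncurry, indicator]
    rw [this]
    exact Measurable.indicator (by fun_prop) (measurableSet_lt (by fun_prop) (by fun_prop))
  have key := lintegral_inner_norm_sq_eq_disc hn ξ hH
  have hhom := lintegral_ball_homogeneous (n := n) (w := fun η => h (inner ℂ ξ.1 η.1)) (by fun_prop)
    (W := fun x => H (inner ℂ ξ.1 x) (‖x‖ ^ 2)) fun η r hr => by
      have hη : ‖η.1‖ = 1 := by simp
      have hs : √(r ^ 2) = r := Real.sqrt_sq hr.le
      have hr' : (r : ℂ) ≠ 0 := by exact_mod_cast hr.ne'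
      have hi : inner ℂ ξ.1 (r • η.1) = r * inner ℂ ξ.1 η.1 := by
        rw [← Complex.coe_smul, inner_smul_right]
      simp only [hHdef, norm_smul, hη, mul_one, Real.norm_of_nonneg hr.le, hs, hi, indicator, mem_Iio,
        sq_lt_one_iff₀ hr.le, inv_mul_cancel_left₀ hr']
  rw [hhom] at key
  have hdisc : ∫⁻ v in Ioi (0 : ℝ), ENNReal.ofReal (v ^ n) *
          ∫⁻ ζ in Metric.ball (0 : ℂ) 1, H (√v * ζ) v * ENNReal.ofReal ((1 - ‖ζ‖ ^ 2) ^ (n - 1)) =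
      ENNReal.ofReal (1 / (n + 1)) *
        ∫⁻ ζ in Metric.ball (0 : ℂ) 1, h ζ * ENNReal.ofReal ((1 - ‖ζ‖ ^ 2) ^ (n - 1)) := by
    have := lintegral_rpow_Ioo (a := n + 1) (τ := 1) (by positivity) zero_le_one
    rw [Real.one_rpow] at this
    rw [← this, ← lintegral_mul_const _ (by fun_prop), ← Iio_inter_Ioi,
      ← Measure.restrict_restrict measurableSet_Iio, ← lintegral_indicator measurableSet_Iio]
    refine setLIntegral_congr_fun measurableSet_Ioi fun v (hv : 0 < v) => ?_
    have hs : (√v : ℂ) ≠ 0 := by exact_mod_cast (Real.sqrt_pos.2 hv).ne'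
    by_cases h1 : v < 1
    · simp [hHdef, h1, inv_mul_cancel_left₀ hs]
    · simp [hHdef, h1]
  rw [hdisc] at key
  have hN : ENNReal.ofReal (2 * (n + 1)) * ENNReal.ofReal (1 / (2 * (n + 1))) = 1 := by
    rw [← ENNReal.ofReal_mul (by positivity), ENNReal.ofReal_eq_one]
    field_simp
  calc _ = ENNReal.ofReal (2 * (n + 1)) * (ENNReal.ofReal (1 / (2 * (n + 1))) *
        ∫⁻ η, h (inner ℂ ξ.1 η.1) ∂(surf n)) := by rw [← mul_assoc, hN, one_mul]
    _ = _ := by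
        rw [key, ← mul_assoc, ← mul_assoc, ← ENNReal.ofReal_mul (by positivity),
          ← ENNReal.ofReal_mul (by positivity)]
        congr 2
        field_simp

/-! ### Integrals over the disc and the volume of the Heisenberg ball -/

/-- Polar coordinates in a half-plane. -/
lemma lintegral_halfPlane_polar {f : ℝ × ℝ → ℝ≥0∞} (hf : Measurable f) :
    ∫⁻ q in {q : ℝ × ℝ | 0 < q.1}, f q =
      ∫⁻ θ in Ioo (-(Real.pi / 2)) (Real.pi / 2), ∫⁻ r in Ioi (0 : ℝ),
        ENNReal.ofReal r * f (r * Real.cos θ, r * Real.sin θ) := by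
  have hms : MeasurableSet {q : ℝ × ℝ | 0 < q.1} := measurableSet_lt (by fun_prop) (by fun_prop)
  have hpi := Real.pi_pos
  rw [← lintegral_indicator hms, ← lintegral_comp_polarCoord_symm, polarCoord_target,
    Measure.volume_eq_prod, ← Measure.prod_restrict, lintegral_prod_symm]
  · simp only [polarCoord_symm_apply, smul_eq_mul]
    have hsub : Ioo (-(Real.pi / 2)) (Real.pi / 2) ⊆ Ioo (-Real.pi) Real.pi :=
      Ioo_subset_Ioo (by linarith) (by linarith)
    have hres : ∀ F : ℝ → ℝ≥0∞, ∫⁻ θ in Ioo (-(Real.pi / 2)) (Real.pi / 2), F θ =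
        ∫⁻ θ in Ioo (-Real.pi) Real.pi, (Ioo (-(Real.pi / 2)) (Real.pi / 2)).indicator F θ :=
      fun F => by
        rw [lintegral_indicator measurableSet_Ioo, Measure.restrict_restrict measurableSet_Ioo,
          inter_eq_left.2 hsub]
    rw [hres]
    refine setLIntegral_congr_fun measurableSet_Ioo fun θ hθ => ?_
    by_cases hθ2 : θ ∈ Ioo (-(Real.pi / 2)) (Real.pi / 2)
    · have hc := Real.cos_pos_of_mem_Ioo hθ2
      rw [indicator_of_mem hθ2]
      refine setLIntegral_congr_fun measurableSet_Ioi fun r (hr : 0 < r) => ?_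
      have : 0 < r * Real.cos θ := by positivity
      simp [this]
    · have hc : Real.cos θ ≤ 0 := by
        rcases le_total 0 θ with h | h
        · exact Real.cos_nonpos_of_pi_div_two_le_of_le
            (not_lt.1 fun h' => hθ2 ⟨by linarith, h'⟩) (by linarith [hθ.2])
        · rw [← Real.cos_neg]
          exact Real.cos_nonpos_of_pi_div_two_le_of_le
            (not_lt.1 fun h' => hθ2 ⟨by linarith, by linarith⟩) (by linarith [hθ.1])
      rw [indicator_of_notMem hθ2]
      refine setLIntegral_eq_zero measurableSet_Ioi fun r (hr : 0 < r) => ?_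
      have : ¬ 0 < r * Real.cos θ := by nlinarith
      simp [this]
  · have hm := hf.indicator hms
    simp only [polarCoord_symm_apply, smul_eq_mul]
    exact Measurable.aemeasurable (by fun_prop)

/-- Polar coordinates about the boundary point `1` of the unit disc: for `ζ = 1 - r e^{iθ}` one has
`1 - |ζ|² = r (2 cos θ - r)`. -/
lemma lintegral_disc_polar (m : ℕ) {h : ℝ → ℝ≥0∞} (hh : Measurable h) :
    ∫⁻ ζ in Metric.ball (0 : ℂ) 1, h ‖1 - ζ‖ * ENNReal.ofReal ((1 - ‖ζ‖ ^ 2) ^ m) =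
      ∫⁻ θ in Ioo (-(Real.pi / 2)) (Real.pi / 2), ∫⁻ r in Ioo 0 (2 * Real.cos θ),
        h r * ENNReal.ofReal (r ^ (m + 1) * (2 * Real.cos θ - r) ^ m) := by
  set g : ℝ × ℝ → ℝ≥0∞ := {q | 0 < 2 * q.1 - (q.1 ^ 2 + q.2 ^ 2)}.indicator fun q =>
    h (√(q.1 ^ 2 + q.2 ^ 2)) * ENNReal.ofReal ((2 * q.1 - (q.1 ^ 2 + q.2 ^ 2)) ^ m) with hg
  have hgm : Measurable g := Measurable.indicator (by fun_prop)
    (measurableSet_lt (by fun_prop) (by fun_prop))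
  have h1 : ∫⁻ ζ in Metric.ball (0 : ℂ) 1, h ‖1 - ζ‖ * ENNReal.ofReal ((1 - ‖ζ‖ ^ 2) ^ m) =
      ∫⁻ q, g q := by
    rw [← lintegral_indicator Metric.isOpen_ball.measurableSet,
      ← lintegral_sub_left_eq_self _ (1 : ℂ),
      ← Complex.volume_preserving_equiv_real_prod.lintegral_comp hgm]
    refine lintegral_congr fun z => ?_
    have e1 : z.re ^ 2 + z.im ^ 2 = ‖z‖ ^ 2 := by
      rw [Complex.sq_norm, Complex.normSq_apply]; ring
    have e2 : 1 - ‖1 - z‖ ^ 2 = 2 * z.re - ‖z‖ ^ 2 := by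
      rw [Complex.sq_norm, Complex.sq_norm, Complex.normSq_apply, Complex.normSq_apply]
      simp
      ring
    have e3 : ‖1 - z‖ < 1 ↔ 0 < 2 * z.re - ‖z‖ ^ 2 := by
      rw [← e2, sub_pos, sq_lt_one_iff₀ (norm_nonneg _)]
    simp only [hg, indicator, Metric.mem_ball, dist_zero_right, mem_ofPred_eq,
      Complex.measurableEquivRealProd_apply, e1, e2, e3, Real.sqrt_sq (norm_nonneg z), sub_sub_cancel]
  have h2 : ∫⁻ q, g q = ∫⁻ q in {q : ℝ × ℝ | 0 < q.1}, g q := by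
    rw [← lintegral_indicator (measurableSet_lt (by fun_prop) (by fun_prop))]
    refine lintegral_congr fun q => ?_
    by_cases hq : 0 < q.1
    · simp [hq]
    · have : ¬ 0 < 2 * q.1 - (q.1 ^ 2 + q.2 ^ 2) := by nlinarith [sq_nonneg q.1, sq_nonneg q.2]
      rw [indicator_of_notMem (by exact hq)]
      exact indicator_of_notMem (by exact this) _
  rw [h1, h2, lintegral_halfPlane_polar hgm]
  refine setLIntegral_congr_fun measurableSet_Ioo fun θ hθ => ?_
  have hc := Real.cos_pos_of_mem_Ioo hθ
  rw [← Ioi_inter_Iio, inter_comm, ← Measure.restrict_restrict measurableSet_Iio,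
    ← lintegral_indicator measurableSet_Iio]
  refine setLIntegral_congr_fun measurableSet_Ioi fun r (hr : 0 < r) => ?_
  have e1 : (r * Real.cos θ) ^ 2 + (r * Real.sin θ) ^ 2 = r ^ 2 := by
    linear_combination r ^ 2 * Real.sin_sq_add_cos_sq θ
  have e2 : 2 * (r * Real.cos θ) - r ^ 2 = r * (2 * Real.cos θ - r) := by ring
  have e3 : 0 < r * (2 * Real.cos θ - r) ↔ r < 2 * Real.cos θ := by
    rw [mul_pos_iff_of_pos_left hr, sub_pos]
  simp only [hg, indicator, mem_ofPred_eq, e1, e2, e3, mem_Iio, Real.sqrt_sq hr.le]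
  split_ifs
  · rw [mul_left_comm, ← ENNReal.ofReal_mul hr.le, mul_pow, pow_succ' r m,
      mul_assoc]
  · simp

/-- `∫_{-π/2}^{π/2} cos^s θ dθ`. -/
noncomputable def cosMoment (s : ℝ) : ℝ≥0∞ :=
  ∫⁻ θ in Ioo (-(Real.pi / 2)) (Real.pi / 2), ENNReal.ofReal (Real.cos θ ^ s)

lemma lintegral_rpow_mul_exp_neg_sq {s : ℝ} (hs : -1 < s) :
    ∫⁻ x in Ioi (0 : ℝ), ENNReal.ofReal (x ^ s * Real.exp (-x ^ 2)) =
      ENNReal.ofReal (Real.Gamma ((s + 1) / 2) / 2) := by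
  have h := integral_rpow_mul_exp_neg_rpow two_pos hs
  simp only [Real.rpow_two] at h
  have hpos : 0 < Real.Gamma ((s + 1) / 2) := Real.Gamma_pos_of_pos (by linarith)
  rw [← ofReal_integral_eq_lintegral_ofReal]
  · rw [h]
    congr 1
    ring
  · by_contra hi
    rw [integral_undef hi] at h
    linarith
  · filter_upwards [ae_restrict_mem measurableSet_Ioi] with x hx
    exact mul_nonneg (Real.rpow_nonneg (le_of_lt hx) _) (Real.exp_pos _).le

/-- Evaluation of `∫ cos^s` by writing `∬_{x>0} x^s e^{-x²-y²}` in cartesian and in polar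
coordinates. -/
lemma cosMoment_eq {s : ℝ} (hs : -1 < s) :
    cosMoment s = ENNReal.ofReal (√Real.pi * Real.Gamma ((s + 1) / 2) / Real.Gamma (s / 2 + 1)) := by
  have hΓ : 0 < Real.Gamma (s / 2 + 1) := Real.Gamma_pos_of_pos (by linarith)
  have hgauss : ∫⁻ y : ℝ, ENNReal.ofReal (Real.exp (-y ^ 2)) = ENNReal.ofReal (√Real.pi) := by
    have h := integral_gaussian 1
    simp only [neg_mul, one_mul, div_one] at h
    rw [← h, ofReal_integral_eq_lintegral_ofReal]
    · simpa using integrable_exp_neg_mul_sq one_pos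
    · exact Filter.Eventually.of_forall fun y => (Real.exp_pos _).le
  set f : ℝ × ℝ → ℝ≥0∞ := fun q =>
    ENNReal.ofReal (q.1 ^ s * Real.exp (-q.1 ^ 2)) * ENNReal.ofReal (Real.exp (-q.2 ^ 2)) with hf
  have hcart : ∫⁻ q in {q : ℝ × ℝ | 0 < q.1}, f q =
      ENNReal.ofReal (Real.Gamma ((s + 1) / 2) / 2) * ENNReal.ofReal (√Real.pi) := by
    have hset : {q : ℝ × ℝ | 0 < q.1} = Ioi 0 ×ˢ univ := by ext; simp
    rw [hset, Measure.volume_eq_prod, ← Measure.prod_restrict, Measure.restrict_univ,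
      hf,
      lintegral_prod_mul (f := fun x : ℝ => ENNReal.ofReal (x ^ s * Real.exp (-x ^ 2)))
        (g := fun y : ℝ => ENNReal.ofReal (Real.exp (-y ^ 2))) (by fun_prop) (by fun_prop),
      lintegral_rpow_mul_exp_neg_sq hs, hgauss]
  have hpolar : ∫⁻ q in {q : ℝ × ℝ | 0 < q.1}, f q =
      cosMoment s * ENNReal.ofReal (Real.Gamma (s / 2 + 1) / 2) := by
    have e := lintegral_rpow_mul_exp_neg_sq (s := s + 1) (by linarith)
    rw [show (s + 1 + 1) / 2 = s / 2 + 1 by ring] at e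
    rw [lintegral_halfPlane_polar (by fun_prop), cosMoment, ← e, ← lintegral_mul_const _ (by fun_prop)]
    refine setLIntegral_congr_fun measurableSet_Ioo fun θ hθ => ?_
    have hc := Real.cos_pos_of_mem_Ioo hθ
    rw [← lintegral_const_mul' _ _ ENNReal.ofReal_ne_top]
    refine setLIntegral_congr_fun measurableSet_Ioi fun r (hr : 0 < r) => ?_
    simp only [hf]
    rw [← ENNReal.ofReal_mul (by positivity), ← ENNReal.ofReal_mul (by positivity),
      ← ENNReal.ofReal_mul (by positivity)]
    have e1 : Real.exp (-r ^ 2) = Real.exp (-(r * Real.cos θ) ^ 2) *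
        Real.exp (-(r * Real.sin θ) ^ 2) := by
      rw [← Real.exp_add]
      congr 1
      linear_combination r ^ 2 * Real.sin_sq_add_cos_sq θ
    rw [e1, Real.mul_rpow hr.le hc.le, Real.rpow_add_one hr.ne']
    congr 1
    ring
  have hΓ' : 0 < Real.Gamma ((s + 1) / 2) := Real.Gamma_pos_of_pos (by linarith)
  rw [hcart, ← ENNReal.ofReal_mul (by positivity)] at hpolar
  have h2 : cosMoment s = ENNReal.ofReal (Real.Gamma ((s + 1) / 2) / 2 * √Real.pi) /
      ENNReal.ofReal (Real.Gamma (s / 2 + 1) / 2) := by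
    rw [hpolar, ENNReal.mul_div_cancel_right (by simpa using hΓ) ENNReal.ofReal_ne_top]
  rw [h2, ← ENNReal.ofReal_div_of_pos (by positivity)]
  congr 1
  field_simp

lemma lintegral_beta {a b : ℝ} (ha : 0 < a) (hb : 0 < b) :
    ∫⁻ x in Ioo (0 : ℝ) 1, ENNReal.ofReal (x ^ (a - 1) * (1 - x) ^ (b - 1)) =
      ENNReal.ofReal (ProbabilityTheory.beta a b) := by
  have hβ := ProbabilityTheory.beta_pos ha hb
  have h := ProbabilityTheory.lintegral_betaPDF_eq_one ha hb
  rw [ProbabilityTheory.lintegral_betaPDF] at h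
  simp only [mul_assoc] at h
  simp only [ENNReal.ofReal_mul (one_div_pos.2 hβ).le] at h
  rw [lintegral_const_mul' _ _ ENNReal.ofReal_ne_top] at h
  have hone : ENNReal.ofReal (ProbabilityTheory.beta a b) *
      ENNReal.ofReal (1 / ProbabilityTheory.beta a b) = 1 := by
    rw [← ENNReal.ofReal_mul hβ.le, mul_one_div_cancel hβ.ne', ENNReal.ofReal_one]
  calc _ = ENNReal.ofReal (ProbabilityTheory.beta a b) *
        (ENNReal.ofReal (1 / ProbabilityTheory.beta a b) * _) := by rw [← mul_assoc, hone, one_mul]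
    _ = _ := by rw [h, mul_one]

lemma lintegral_beta_scaled {a b c : ℝ} (ha : 0 < a) (hb : 0 < b) (hc : 0 < c) :
    ∫⁻ x in Ioo (0 : ℝ) c, ENNReal.ofReal (x ^ (a - 1) * (c - x) ^ (b - 1)) =
      ENNReal.ofReal (c ^ (a + b - 1)) * ENNReal.ofReal (ProbabilityTheory.beta a b) := by
  rw [← lintegral_beta ha hb, ← lintegral_indicator measurableSet_Ioo,
    lintegral_eq_lintegral_comp_smul volume hc
      (Measurable.indicator (by fun_prop) measurableSet_Ioo),
    ← lintegral_indicator measurableSet_Ioo, ← lintegral_const_mul' _ _ ENNReal.ofReal_ne_top,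
    ← lintegral_const_mul' _ _ ENNReal.ofReal_ne_top]
  refine lintegral_congr fun x => ?_
  have hiff : c • x ∈ Ioo 0 c ↔ x ∈ Ioo (0 : ℝ) 1 := by
    rw [smul_eq_mul, mem_Ioo, mem_Ioo, mul_pos_iff_of_pos_left hc, mul_lt_iff_lt_one_right hc]
  by_cases hx : x ∈ Ioo (0 : ℝ) 1
  · rw [indicator_of_mem hx, indicator_of_mem (hiff.2 hx), ← ENNReal.ofReal_mul (by positivity),
      ← ENNReal.ofReal_mul (by positivity)]
    have h1 : 0 < 1 - x := by linarith [hx.2]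
    have e : c - c • x = c * (1 - x) := by simp; ring
    rw [e, smul_eq_mul, Real.mul_rpow hc.le hx.1.le, Real.mul_rpow hc.le h1.le,
      show a + b - 1 = 1 + (a - 1) + (b - 1) by ring, Real.rpow_add hc, Real.rpow_add hc,
      Real.rpow_one, Module.finrank_self, pow_one]
    congr 1
    ring
  · rw [indicator_of_notMem hx, indicator_of_notMem (mt hiff.1 hx), mul_zero, mul_zero]

/-- The integral of a power of `|1 - ζ|` against the density on the disc. -/
lemma lintegral_disc_rpow {n : ℕ} (hn : 1 ≤ n) {b : ℝ} (hb : 0 < b) :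
    ∫⁻ ζ in Metric.ball (0 : ℂ) 1, ENNReal.ofReal (‖1 - ζ‖ ^ b) *
        ENNReal.ofReal ((1 - ‖ζ‖ ^ 2) ^ (n - 1)) =
      ENNReal.ofReal (Real.pi * (n - 1).factorial * Real.Gamma (b + n + 1) /
        Real.Gamma (b / 2 + n + 1) ^ 2) := by
  have hn0 : (0 : ℝ) < n := by exact_mod_cast hn
  rw [lintegral_disc_polar (n - 1) (h := fun r => ENNReal.ofReal (r ^ b)) (by fun_prop)]
  have hin : ∀ θ ∈ Ioo (-(Real.pi / 2)) (Real.pi / 2), ∫⁻ r in Ioo 0 (2 * Real.cos θ),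
      ENNReal.ofReal (r ^ b) * ENNReal.ofReal (r ^ (n - 1 + 1) * (2 * Real.cos θ - r) ^ (n - 1)) =
      ENNReal.ofReal (2 ^ (b + 2 * n) * ProbabilityTheory.beta (b + n + 1) n) *
        ENNReal.ofReal (Real.cos θ ^ (b + 2 * n)) := fun θ hθ => by
    have hc := Real.cos_pos_of_mem_Ioo hθ
    have h := lintegral_beta_scaled (a := b + n + 1) (b := n) (by positivity) hn0
      (by positivity : 0 < 2 * Real.cos θ)
    have hβ := ProbabilityTheory.beta_pos (by positivity : 0 < b + n + 1) hn0
    calc _ = _ := ?_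
      _ = _ := h
      _ = _ := ?_
    · refine setLIntegral_congr_fun measurableSet_Ioo fun r hr => ?_
      have hr0 : 0 < r := hr.1
      rw [← ENNReal.ofReal_mul (by positivity), Nat.sub_add_cancel hn, ← mul_assoc,
        ← Real.rpow_natCast, ← Real.rpow_add hr0, ← Real.rpow_natCast, Nat.cast_pred hn]
      congr 3
      ring
    · rw [← ENNReal.ofReal_mul (by positivity), ← ENNReal.ofReal_mul (by positivity),
        show b + n + 1 + n - 1 = b + 2 * n by ring, Real.mul_rpow zero_le_two hc.le]
      congr 1
      ring
  rw [setLIntegral_congr_fun measurableSet_Ioo hin, lintegral_const_mul' _ _ ENNReal.ofReal_ne_top]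
  change _ * cosMoment (b + 2 * n) = _
  have hβ := ProbabilityTheory.beta_pos (by positivity : 0 < b + n + 1) hn0
  rw [cosMoment_eq (by linarith), ← ENNReal.ofReal_mul (by positivity)]
  congr 1
  -- Legendre's duplication formula removes the factor `Γ((b + 2n + 1)/2)` from `cosMoment`.
  have hdup := Real.Gamma_mul_Gamma_add_half ((b + 2 * n + 1) / 2)
  rw [show (b + 2 * n + 1) / 2 + 1 / 2 = b / 2 + n + 1 by ring,
    show 2 * ((b + 2 * n + 1) / 2) = b + 2 * n + 1 by ring,
    show 1 - (b + 2 * n + 1) = -(b + 2 * n) by ring, Real.rpow_neg zero_le_two] at hdup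
  have hg1 : 0 < Real.Gamma (b / 2 + n + 1) := Real.Gamma_pos_of_pos (by positivity)
  have hg2 : 0 < Real.Gamma (b + 2 * n + 1) := Real.Gamma_pos_of_pos (by positivity)
  have hfac : Real.Gamma n = (n - 1).factorial := by
    rw [← Real.Gamma_nat_eq_factorial, Nat.cast_pred hn, sub_add_cancel]
  have h2 : (0 : ℝ) < 2 ^ (b + 2 * n) := by positivity
  have hpi := Real.mul_self_sqrt Real.pi_pos.le
  rw [ProbabilityTheory.beta, hfac, show b + n + 1 + n = b + 2 * n + 1 by ring,
    show (b + 2 * n) / 2 + 1 = b / 2 + n + 1 by ring]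
  have hG : Real.Gamma ((b + 2 * n + 1) / 2) =
      Real.Gamma (b + 2 * n + 1) * (2 ^ (b + 2 * n))⁻¹ * √Real.pi / Real.Gamma (b / 2 + n + 1) := by
    rw [eq_div_iff hg1.ne', hdup]
  rw [hG]
  field_simp
  nlinarith

/-- The part of the disc within distance `ρ` of the boundary point `1`. -/
lemma lintegral_disc_near_one_le {n : ℕ} (hn : 1 ≤ n) {ρ : ℝ} (hρ : 0 < ρ) :
    ∫⁻ ζ in Metric.ball (0 : ℂ) 1, (Iio ρ).indicator (fun _ => (1 : ℝ≥0∞)) ‖1 - ζ‖ *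
        ENNReal.ofReal ((1 - ‖ζ‖ ^ 2) ^ (n - 1)) ≤
      ENNReal.ofReal (2 ^ (n - 1) / (n + 1) * ρ ^ (n + 1)) * cosMoment (n - 1) := by
  rw [lintegral_disc_polar (n - 1) (h := (Iio ρ).indicator fun _ => 1)
    (measurable_const.indicator measurableSet_Iio), cosMoment,
    ← lintegral_const_mul' _ _ ENNReal.ofReal_ne_top]
  refine setLIntegral_mono' measurableSet_Ioo fun θ hθ => ?_
  have hc := Real.cos_pos_of_mem_Ioo hθ
  have hpow := lintegral_rpow_Ioo (a := n + 1) (by positivity) hρ.le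
  have hcos : Real.cos θ ^ ((n : ℝ) - 1) = Real.cos θ ^ (n - 1) := by
    rw [← Nat.cast_pred hn, Real.rpow_natCast]
  calc _ ≤ ∫⁻ r in Ioo 0 (2 * Real.cos θ), (Iio ρ).indicator
        (fun r => ENNReal.ofReal ((2 * Real.cos θ) ^ (n - 1)) *
          ENNReal.ofReal (r ^ ((n : ℝ) + 1 - 1))) r := by
        refine setLIntegral_mono' measurableSet_Ioo fun r hr => ?_
        have hr0 : 0 < r := hr.1
        by_cases h : r ∈ Iio ρ
        · rw [indicator_of_mem h, indicator_of_mem h, one_mul, ← ENNReal.ofReal_mul (by positivity),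
            Nat.sub_add_cancel hn, add_sub_cancel_right, Real.rpow_natCast, mul_comm]
          refine ENNReal.ofReal_le_ofReal (mul_le_mul_of_nonneg_right ?_ (by positivity))
          exact pow_le_pow_left₀ (by linarith [hr.2]) (by linarith) _
        · simp [h]
    _ ≤ ∫⁻ r in Ioi 0, (Iio ρ).indicator
        (fun r => ENNReal.ofReal ((2 * Real.cos θ) ^ (n - 1)) *
          ENNReal.ofReal (r ^ ((n : ℝ) + 1 - 1))) r :=
        lintegral_mono_set Ioo_subset_Ioi_self
    _ = _ := by
        rw [lintegral_indicator measurableSet_Iio, Measure.restrict_restrict measurableSet_Iio,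
          Iio_inter_Ioi, lintegral_const_mul' _ _ ENNReal.ofReal_ne_top, hpow, hcos,
          ← ENNReal.ofReal_mul (by positivity), ← ENNReal.ofReal_mul (by positivity)]
        congr 1
        rw [mul_pow, ← Nat.cast_add_one, Real.rpow_natCast]
        ring

/-- The volume of the unit ball of the Heisenberg group, by polar coordinates in `(|z|², t)`. -/
lemma volume_heisenberg_ball {n : ℕ} (hn : 1 ≤ n) :
    (volume : Measure (EuclideanSpace ℂ (Fin n) × ℝ)) {u | heisenbergNorm u < 1} =
      ENNReal.ofReal (Real.pi ^ n / (n - 1).factorial * (1 / (n + 1))) * cosMoment (n - 1) := by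
  set S : Set (ℝ × ℝ) := {q | q.1 ^ 2 + q.2 ^ 2 < 1} with hSdef
  have hS : MeasurableSet S := measurableSet_lt (by fun_prop) (by fun_prop)
  have hI : Measurable (S.indicator fun _ => (1 : ℝ≥0∞)) := measurable_const.indicator hS
  have hset : {u : EuclideanSpace ℂ (Fin n) × ℝ | heisenbergNorm u < 1} =
      (fun u => (‖u.1‖ ^ 2, u.2)) ⁻¹' S := by
    ext u
    have h0 : 0 ≤ ‖u.1‖ ^ 4 + u.2 ^ 2 := by positivity
    simp only [heisenbergNorm, mem_ofPred_eq, mem_preimage, hSdef, ← pow_mul]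
    rw [← Real.rpow_lt_rpow_iff h0 zero_le_one (by norm_num : (0 : ℝ) < 1 / 4), Real.one_rpow]
  have hvol : (volume : Measure (EuclideanSpace ℂ (Fin n) × ℝ)) {u | heisenbergNorm u < 1} =
      ∫⁻ t : ℝ, ∫⁻ z : EuclideanSpace ℂ (Fin n), S.indicator (fun _ => (1 : ℝ≥0∞)) (‖z‖ ^ 2, t) := by
    rw [hset, ← lintegral_indicator_one (hS.preimage (by fun_prop)), Measure.volume_eq_prod,
      lintegral_prod_symm]
    · rfl
    · exact (measurable_const.indicator (hS.preimage (by fun_prop))).aemeasurable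
  set f : ℝ × ℝ → ℝ≥0∞ := fun q =>
    S.indicator (fun _ => (1 : ℝ≥0∞)) q * ENNReal.ofReal (q.1 ^ (n - 1)) with hf
  have hfm : Measurable f := by fun_prop
  have hplane : ∫⁻ q in {q : ℝ × ℝ | 0 < q.1}, f q = ∫⁻ t : ℝ, ∫⁻ u in Ioi (0 : ℝ), f (u, t) := by
    have hset : {q : ℝ × ℝ | 0 < q.1} = Ioi 0 ×ˢ univ := by ext; simp
    rw [hset, Measure.volume_eq_prod, ← Measure.prod_restrict, Measure.restrict_univ,
      lintegral_prod_symm _ hfm.aemeasurable]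
  have hpolar : ∫⁻ q in {q : ℝ × ℝ | 0 < q.1}, f q =
      ENNReal.ofReal (1 / (n + 1)) * cosMoment (n - 1) := by
    have hpow := lintegral_rpow_Ioo (a := n + 1) (by positivity) zero_le_one
    rw [Real.one_rpow] at hpow
    rw [lintegral_halfPlane_polar hfm, cosMoment, ← lintegral_const_mul' _ _ ENNReal.ofReal_ne_top]
    refine setLIntegral_congr_fun measurableSet_Ioo fun θ hθ => ?_
    have hc := Real.cos_pos_of_mem_Ioo hθ
    have hcos : Real.cos θ ^ ((n : ℝ) - 1) = Real.cos θ ^ (n - 1) := by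
      rw [← Nat.cast_pred hn, Real.rpow_natCast]
    rw [← hpow, hcos, ← lintegral_mul_const _ (by fun_prop), ← Iio_inter_Ioi,
      ← Measure.restrict_restrict measurableSet_Iio, ← lintegral_indicator measurableSet_Iio]
    refine setLIntegral_congr_fun measurableSet_Ioi fun r (hr : 0 < r) => ?_
    have e1 : (r * Real.cos θ) ^ 2 + (r * Real.sin θ) ^ 2 = r ^ 2 := by
      linear_combination r ^ 2 * Real.sin_sq_add_cos_sq θ
    simp only [hf, hSdef, indicator, mem_ofPred_eq, e1, sq_lt_one_iff₀ hr.le, mem_Iio]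
    split_ifs
    · rw [one_mul, ← ENNReal.ofReal_mul hr.le, ← ENNReal.ofReal_mul (by positivity),
        add_sub_cancel_right, Real.rpow_natCast, mul_pow, ← mul_assoc, ← pow_succ',
        Nat.sub_add_cancel hn]
    · simp
  rw [hvol, ENNReal.ofReal_mul (by positivity), mul_assoc, ← hpolar, hplane,
    ← lintegral_const_mul' _ _ ENNReal.ofReal_ne_top]
  refine lintegral_congr fun t => ?_
  exact lintegral_norm_sq hn (k := fun u => S.indicator (fun _ => (1 : ℝ≥0∞)) (u, t)) (by fun_prop)

/-! ### The inequality on the sphere -/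

lemma norm_one_sub_hermDot {n : ℕ} (ξ η : Sph n) :
    ‖1 - hermDot ξ η‖ = ‖1 - inner ℂ ξ.1 η.1‖ := by
  have : hermDot ξ η = (starRingEnd ℂ) (inner ℂ ξ.1 η.1) := by
    rw [inner_conj_symm, PiLp.inner_apply]
    rfl
  rw [this, ← RCLike.norm_conj (1 - inner ℂ ξ.1 η.1), map_sub, map_one]

lemma homDim_pos (n : ℕ) : 0 < homDim n := by unfold homDim; positivity

lemma surf_univ {n : ℕ} : surf n univ = ENNReal.ofReal (2 * Real.pi ^ (n + 1) / n.factorial) := by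
  have hball : Metric.ball (0 : EuclideanSpace ℂ (Fin (n + 1))) 1 = {y | ‖y‖ ^ 2 < 1} := by
    ext y
    simp
  rw [surf, Measure.toSphere_apply_univ, hball, volume_norm_sq_lt (by omega) zero_le_one,
    finrank_real_euclideanSpace_complex, ← ENNReal.ofReal_natCast,
    ← ENNReal.ofReal_mul (by positivity)]
  congr 1
  rw [Nat.factorial_succ]
  push_cast
  field_simp
  simp

lemma lintegral_kern {n : ℕ} (hn : 1 ≤ n) {α : ℝ} (hα : homDim n < α) (ξ : Sph n) :
    ∫⁻ η, ENNReal.ofReal (kern n α ξ η) ∂(surf n) =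
      ENNReal.ofReal (2 * Real.pi ^ (n + 1) * Real.Gamma (α / 2) /
        Real.Gamma ((homDim n + α) / 4) ^ 2) := by
  have hb : 0 < (α - homDim n) / 2 := by linarith
  simp only [kern, norm_one_sub_hermDot]
  have hg1 : 0 < Real.Gamma ((homDim n + α) / 4) :=
    Real.Gamma_pos_of_pos (by have := homDim_pos n; linarith)
  rw [lintegral_surf_inner hn ξ (h := fun ζ => ENNReal.ofReal (‖1 - ζ‖ ^ ((α - homDim n) / 2)))
    (by fun_prop), lintegral_disc_rpow hn hb, ← ENNReal.ofReal_mul (by positivity)]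
  have e1 : (α - homDim n) / 2 + n + 1 = α / 2 := by unfold homDim; ring
  have e2 : (α - homDim n) / 2 / 2 + n + 1 = (homDim n + α) / 4 := by unfold homDim; ring
  rw [e1, e2]
  congr 1
  field_simp
  ring

/-- The measure of a non-isotropic ball of the sphere is at most its value in the tangent Heisenberg
group. -/
lemma surf_ball_le {n : ℕ} (hn : 1 ≤ n) (ξ : Sph n) {ρ : ℝ} (hρ : 0 < ρ) :
    surf n {η | ‖1 - hermDot ξ η‖ < ρ} ≤
      ENNReal.ofReal (2 ^ n * volB1 n * ρ ^ ((n : ℝ) + 1)) := by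
  have hS : MeasurableSet {η : Sph n | ‖1 - hermDot ξ η‖ < ρ} := by
    simp only [norm_one_sub_hermDot]
    exact measurableSet_lt (by fun_prop) (by fun_prop)
  have hfin : cosMoment (n - 1) ≠ ∞ := by
    rw [cosMoment_eq (by have : (1 : ℝ) ≤ n := by exact_mod_cast hn
                         linarith)]
    exact ENNReal.ofReal_ne_top
  have hvol : volB1 n = Real.pi ^ n / (n - 1).factorial * (1 / (n + 1)) *
      (cosMoment (n - 1)).toReal := by
    rw [volB1, Measure.real, volume_heisenberg_ball hn, ENNReal.toReal_mul,
      ENNReal.toReal_ofReal (by positivity)]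
  calc _ = ∫⁻ η, (Iio ρ).indicator (fun _ => (1 : ℝ≥0∞)) ‖1 - inner ℂ ξ.1 η.1‖ ∂(surf n) := by
        rw [← lintegral_indicator_one hS]
        refine lintegral_congr fun η => ?_
        simp [indicator, norm_one_sub_hermDot]
    _ ≤ ENNReal.ofReal (2 * Real.pi ^ n / (n - 1).factorial) *
          (ENNReal.ofReal (2 ^ (n - 1) / (n + 1) * ρ ^ (n + 1)) * cosMoment (n - 1)) := by
        have hI : Measurable ((Iio ρ).indicator fun _ : ℝ => (1 : ℝ≥0∞)) :=
          measurable_const.indicator measurableSet_Iio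
        rw [lintegral_surf_inner hn ξ
          (h := fun ζ => (Iio ρ).indicator (fun _ => (1 : ℝ≥0∞)) ‖1 - ζ‖)
          (hI.comp (by fun_prop : Measurable fun ζ : ℂ => ‖1 - ζ‖))]
        gcongr
        exact lintegral_disc_near_one_le hn hρ
    _ = _ := by
        rw [← ENNReal.ofReal_toReal hfin, ← ENNReal.ofReal_mul (by positivity),
          ← ENNReal.ofReal_mul (by positivity), hvol,
          ← Nat.cast_add_one, Real.rpow_natCast]
        congr 1
        have : (2 : ℝ) ^ n = 2 * 2 ^ (n - 1) := by rw [← pow_succ', Nat.sub_add_cancel hn]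
        rw [this]
        field_simp

lemma volB1_pos {n : ℕ} (hn : 1 ≤ n) : 0 < volB1 n := by
  have h1 : (1 : ℝ) ≤ n := by exact_mod_cast hn
  rw [volB1, Measure.real, volume_heisenberg_ball hn, cosMoment_eq (by linarith),
    ← ENNReal.ofReal_mul (by positivity)]
  have g1 : 0 < Real.Gamma (((n : ℝ) - 1 + 1) / 2) := Real.Gamma_pos_of_pos (by linarith)
  have g2 : 0 < Real.Gamma (((n : ℝ) - 1) / 2 + 1) := Real.Gamma_pos_of_pos (by linarith)
  rw [ENNReal.toReal_ofReal (by positivity)]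
  positivity

lemma pExp_pos {n : ℕ} {α : ℝ} (hα : homDim n < α) : 0 < pExp n α := by
  have := homDim_pos n
  unfold pExp
  have : 0 < homDim n + α := by linarith
  positivity

/-- `upperBound` in terms of `|𝕊^{2n+1}| = 2π^{n+1}/n!` and of the integral of the kernel. -/
lemma upperBound_eq {n : ℕ} {α : ℝ} (hα : homDim n < α) :
    upperBound n α = (2 * Real.pi ^ (n + 1) / n.factorial) ^ (1 - 2 / pExp n α) *
      (2 * Real.pi ^ (n + 1) * Real.Gamma (α / 2) / Real.Gamma ((homDim n + α) / 4) ^ 2) := by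
  have hQ := homDim_pos n
  have hs : 0 < 2 * Real.pi ^ (n + 1) / (n.factorial : ℝ) := by positivity
  have e : (homDim n - α) / homDim n = (1 - 2 / pExp n α) + 1 := by
    unfold pExp
    have : homDim n + α ≠ 0 := by linarith
    field_simp
    ring
  rw [upperBound, e, Real.rpow_add_one hs.ne']
  field_simp

lemma energy_congr {n : ℕ} {α : ℝ} {f f' g g' : Sph n → ℝ} (hf : f =ᵐ[surf n] f')
    (hg : g =ᵐ[surf n] g') : energy n α f g = energy n α f' g' := by
  unfold energy
  refine lintegral_congr_ae ?_
  filter_upwards [hf] with ξ hξ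
  refine lintegral_congr_ae ?_
  filter_upwards [hg] with η hη
  rw [hξ, hη]

instance (n : ℕ) : IsFiniteMeasure (surf n) := by unfold surf; infer_instance

/-- An admissible function has a measurable nonnegative representative, and its quasi-norm is
`P^{1/p}` with `0 < P = ∫ f^p < ∞`. -/
lemma Admissible.exists_rep {n : ℕ} {α : ℝ} (hα : homDim n < α) {f : Sph n → ℝ}
    (hf : Admissible n α f) :
    ∃ f' : Sph n → ℝ, ∃ P : ℝ, Measurable f' ∧ (∀ ξ, 0 ≤ f' ξ) ∧ f =ᵐ[surf n] f' ∧ 0 < P ∧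
      ∫⁻ ξ, ENNReal.ofReal (f' ξ ^ pExp n α) ∂(surf n) = ENNReal.ofReal P ∧
      eLpNorm f (ENNReal.ofReal (pExp n α)) (surf n) = ENNReal.ofReal (P ^ (1 / pExp n α)) := by
  obtain ⟨hf0, hfL, hfne⟩ := hf
  have hp := pExp_pos hα
  set g := hfL.1.mk f with hg
  have hgm : Measurable g := hfL.1.measurable_mk
  have hfg : f =ᵐ[surf n] fun ξ => max (g ξ) 0 := by
    filter_upwards [hfL.1.ae_eq_mk] with ξ hξ
    rw [hg, ← hξ, max_eq_left (hf0 ξ)]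
  have hnorm : eLpNorm f (ENNReal.ofReal (pExp n α)) (surf n) =
      (∫⁻ ξ, ENNReal.ofReal (max (g ξ) 0 ^ pExp n α) ∂(surf n)) ^ (1 / pExp n α) := by
    rw [eLpNorm_congr_ae hfg, eLpNorm_eq_lintegral_rpow_enorm_toReal (by simpa using hp) (by simp),
      ENNReal.toReal_ofReal hp.le]
    congr 1
    refine lintegral_congr fun ξ => ?_
    rw [Real.enorm_eq_ofReal (le_max_right _ _), ENNReal.ofReal_rpow_of_nonneg (le_max_right _ _) hp.le]
  have hne : eLpNorm f (ENNReal.ofReal (pExp n α)) (surf n) ≠ 0 := fun h =>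
    hfne ((eLpNorm_eq_zero_iff hfL.1 (by simpa using hp)).1 h)
  have htop := hfL.2.ne
  set I := ∫⁻ ξ, ENNReal.ofReal (max (g ξ) 0 ^ pExp n α) ∂(surf n) with hI
  have hp' : 0 < 1 / pExp n α := by positivity
  have hI0 : I ≠ 0 := fun h => hne (by rw [hnorm, h, ENNReal.zero_rpow_of_pos hp'])
  have hItop : I ≠ ∞ := fun h => htop (by rw [hnorm, h, ENNReal.top_rpow_of_pos hp'])
  have hP : 0 < I.toReal := ENNReal.toReal_pos hI0 hItop
  refine ⟨fun ξ => max (g ξ) 0, I.toReal, by fun_prop, fun ξ => le_max_right _ _, hfg, hP,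
    (ENNReal.ofReal_toReal hItop).symm, ?_⟩
  rw [hnorm, ← ENNReal.ofReal_rpow_of_pos hP, ENNReal.ofReal_toReal hItop]

lemma lowerBound_eq {n : ℕ} (hn : 1 ≤ n) (α : ℝ) :
    lowerBound n α = (8 * (2 ^ n * volB1 n)) ^ (-((α - homDim n) / 2 / (n + 1))) /
      (2 * pExp n α ^ 2) := by
  have hV := volB1_pos hn
  have e : (homDim n - α) / homDim n = -((α - homDim n) / 2 / (n + 1)) := by
    unfold homDim; field_simp; ring
  have e' : (α - homDim n) / homDim n = (α - homDim n) / 2 / (n + 1) := by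
    unfold homDim; field_simp
  rw [lowerBound, e, e', show 8 * (2 ^ n * volB1 n) = 8 * volB1 n * 2 ^ n by ring,
    Real.mul_rpow (x := 8 * volB1 n) (by positivity) (by positivity), ← Real.rpow_natCast 2 n,
    ← Real.rpow_mul zero_le_two, mul_neg, Real.rpow_neg zero_le_two, Real.rpow_add two_pos,
    Real.rpow_one]
  field_simp

lemma lowerBound_pos {n : ℕ} (hn : 1 ≤ n) {α : ℝ} (hα : homDim n < α) : 0 < lowerBound n α := by
  have hV := volB1_pos hn
  have hp := pExp_pos hα
  rw [lowerBound_eq hn]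
  positivity

lemma lowerBound_le_hlsQuotient {n : ℕ} (hn : 1 ≤ n) {α : ℝ} (hα : homDim n < α)
    {f g : Sph n → ℝ} (hf : Admissible n α f) (hg : Admissible n α g) :
    ENNReal.ofReal (lowerBound n α) ≤ hlsQuotient n α f g := by
  obtain ⟨f', P, hfm, hf0, hff, hP, hfP, hfN⟩ := hf.exists_rep hα
  obtain ⟨g', S, hgm, hg0, hgg, hS, hgS, hgN⟩ := hg.exists_rep hα
  have hp := pExp_pos hα
  have hV := volB1_pos hn
  rw [hlsQuotient, energy_congr hff hgg, hfN, hgN, ← ENNReal.ofReal_mul (by positivity),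
    ENNReal.le_div_iff_mul_le (Or.inl (by simpa using by positivity)) (Or.inl (by simp)),
    ← ENNReal.ofReal_mul (lowerBound_pos hn hα).le, lowerBound_eq hn]
  have hsymm : ∀ ξ η : Sph n, ‖1 - hermDot ξ η‖ = ‖1 - hermDot η ξ‖ := fun ξ η => by
    rw [norm_one_sub_hermDot, norm_one_sub_hermDot, ← inner_conj_symm,
      ← RCLike.norm_conj (1 - inner ℂ η.1 ξ.1), map_sub, map_one]
  refine reversed_hls (ν := surf n) (D := fun ξ η => ‖1 - hermDot ξ η‖) ?_
    (fun _ _ => norm_nonneg _) hsymm (by linarith) (by positivity) (by positivity) hp ?_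
    (fun ξ ρ hρ => surf_ball_le hn ξ hρ) hfm hf0 hgm hg0 hP hS hfP hgS
  · simp only [norm_one_sub_hermDot]
    unfold Function.uncurry
    fun_prop
  · have h1 : (α - homDim n) / 2 / ((n : ℝ) + 1) = (α - homDim n) / homDim n := by
      unfold homDim; field_simp
    have hQ := homDim_pos n
    have h2 : homDim n + α ≠ 0 := by linarith
    rw [h1, pExp]
    field_simp
    ring

lemma hlsQuotient_const {n : ℕ} (hn : 1 ≤ n) {α : ℝ} (hα : homDim n < α) {a b : ℝ} (ha : 0 < a)
    (hb : 0 < b) :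
    hlsQuotient n α (fun _ => a) (fun _ => b) = ENNReal.ofReal (upperBound n α) := by
  have hp := pExp_pos hα
  have hs : 0 < 2 * Real.pi ^ (n + 1) / (n.factorial : ℝ) := by positivity
  have hg1 : 0 < Real.Gamma ((homDim n + α) / 4) :=
    Real.Gamma_pos_of_pos (by have := homDim_pos n; linarith)
  have hg2 : 0 < Real.Gamma (α / 2) := Real.Gamma_pos_of_pos (by have := homDim_pos n; linarith)
  have hE : energy n α (fun _ => a) (fun _ => b) = ENNReal.ofReal (a * b) *
      ENNReal.ofReal (2 * Real.pi ^ (n + 1) * Real.Gamma (α / 2) /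
        Real.Gamma ((homDim n + α) / 4) ^ 2) *
      ENNReal.ofReal (2 * Real.pi ^ (n + 1) / n.factorial) := by
    unfold energy
    simp only [ENNReal.ofReal_mul (mul_pos ha hb).le,
      lintegral_const_mul' _ _ ENNReal.ofReal_ne_top, lintegral_kern hn hα, lintegral_const, surf_univ]
    exact (mul_assoc _ _ _).symm
  have hN : ∀ c : ℝ, 0 < c → eLpNorm (fun _ => c) (ENNReal.ofReal (pExp n α)) (surf n) =
      ENNReal.ofReal (c * (2 * Real.pi ^ (n + 1) / n.factorial) ^ (1 / pExp n α)) := fun c hc => by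
    rw [eLpNorm_const' _ (by simpa using hp) (by simp), ENNReal.toReal_ofReal hp.le, surf_univ,
      ENNReal.ofReal_rpow_of_pos hs, Real.enorm_eq_ofReal hc.le, ← ENNReal.ofReal_mul hc.le]
  rw [hlsQuotient, hE, hN a ha, hN b hb, ← ENNReal.ofReal_mul (by positivity),
    ← ENNReal.ofReal_mul (by positivity), ← ENNReal.ofReal_mul (by positivity),
    ← ENNReal.ofReal_div_of_pos (by positivity), upperBound_eq hα, Real.rpow_sub hs, Real.rpow_one,
    show 2 / pExp n α = 1 / pExp n α + 1 / pExp n α by ring, Real.rpow_add hs]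
  congr 1
  field_simp

lemma admissible_one {n : ℕ} (α : ℝ) : Admissible n α fun _ => 1 := by
  refine ⟨fun _ => zero_le_one, memLp_const _, fun h => ?_⟩
  have h0 : surf n univ = 0 := by
    refine measure_mono_null (fun ξ _ => ?_) h
    simp
  rw [surf_univ, ENNReal.ofReal_eq_zero] at h0
  have : 0 < 2 * Real.pi ^ (n + 1) / (n.factorial : ℝ) := by positivity
  linarith

end CRSphere

theorem mainTheorem3 (n : ℕ) (hn : 1 ≤ n) (α : ℝ) (hα : CRSphere.homDim n < α) :
    0 < CRSphere.lowerBound n α ∧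
    ENNReal.ofReal (CRSphere.lowerBound n α) ≤ CRSphere.sharpConst n α ∧
    CRSphere.sharpConst n α ≤ ENNReal.ofReal (CRSphere.upperBound n α) ∧
    (∀ ξ : CRSphere.Sph n,
      CRSphere.upperBound n α =
        (CRSphere.surf n).real Set.univ ^ (1 - 2 / CRSphere.pExp n α) *
          ∫ η, CRSphere.kern n α ξ η ∂(CRSphere.surf n)) ∧
    (∀ a b : ℝ, 0 < a → 0 < b →
      CRSphere.hlsQuotient n α (fun _ => a) (fun _ => b) =
        ENNReal.ofReal (CRSphere.upperBound n α)) := by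
  have hg1 : 0 < Real.Gamma ((CRSphere.homDim n + α) / 4) :=
    Real.Gamma_pos_of_pos (by have := CRSphere.homDim_pos n; linarith)
  have hg2 : 0 < Real.Gamma (α / 2) :=
    Real.Gamma_pos_of_pos (by have := CRSphere.homDim_pos n; linarith)
  refine ⟨CRSphere.lowerBound_pos hn hα, ?_, ?_, fun ξ => ?_, fun a b ha hb =>
    CRSphere.hlsQuotient_const hn hα ha hb⟩
  · exact le_iInf fun f => le_iInf fun g => le_iInf fun hf => le_iInf fun hg =>
      CRSphere.lowerBound_le_hlsQuotient hn hα hf hg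
  · rw [← CRSphere.hlsQuotient_const hn hα one_pos one_pos]
    exact iInf_le_of_le _ (iInf_le_of_le _ (iInf_le_of_le (CRSphere.admissible_one α)
      (iInf_le _ (CRSphere.admissible_one α))))
  · have hmeas : Measurable fun η => CRSphere.kern n α ξ η := by
      simp only [CRSphere.kern, CRSphere.norm_one_sub_hermDot]
      fun_prop
    rw [CRSphere.upperBound_eq hα, Measure.real, CRSphere.surf_univ,
      ENNReal.toReal_ofReal (by positivity), integral_eq_lintegral_of_nonneg_ae
        (f := fun η => CRSphere.kern n α ξ η)
        (Filter.Eventually.of_forall fun η => Real.rpow_nonneg (norm_nonneg _) _)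
        hmeas.aestronglyMeasurable, CRSphere.lintegral_kern hn hα,
      ENNReal.toReal_ofReal (by positivity)]
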